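/- Consider programs of a fixed deterministic WHILE language over binary trees which may call a SAT solver. A SAT solver takes a formula $\varphi$ in conjunctive normal form and returns a satisfying valuation of its variables if there is one, and the answer "unsatisfiable" otherwise. The running time of a program counts every instruction with one plus the size of the datum it is applied to (plus the size of the answer, for a solver call), but not the work of the solver. For a finite non-empty alphabet $\Sigma$, a finite set $\mathcal P\subseteq\Sigma^*$ and an integer $n\ge 1$, let $\mathsf{Rec}(\mathcal P,n)$ be the set of complete deterministic finite automata $\mathcal A$ over $\Sigma$ with at most $n$ states whose language $\mathcal L(\mathcal A)$ contains $\mathcal P$, let $\Sigma^{\le h}$ be the set of words of length at most $h$, and let $\mathsf{Pref}(\mathcal P)$ be the set of prefixes of words of $\mathcal P$. There are one such program and a constant $c$ such that, for every SAT solver, all $\Sigma$, $\mathcal P$ and $n$ as above, the program, given $|\Sigma|$, $n$ and any repetition-free list of the words of $\mathcal P$ (with $\Sigma=\{0,\dots,|\Sigma|-1\}$ and numbers written in unary), halts and outputs an automaton $\mathcal A\in\mathsf{Rec}(\mathcal P,n)$ such that no $\mathcal A'\in\mathsf{Rec}(\mathcal P,n)$ satisfies $|\mathcal L(\mathcal A')\cap\Sigma^{\le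 2n-2}|<|\mathcal L(\mathcal A)\cap\Sigma^{\le 2n-2}|$. Moreover: 1. it calls the SAT solver at most $c\,(|\Sigma|+n)^c$ times, and at most $(2n-1)\cdot\log_2|\Sigma|$ times if $|\Sigma|\ge 2$; 2. every formula on which it calls the solver has size at most $c\,(|\Sigma|+|\mathsf{Pref}(\mathcal P)|+n)^c$; 3. its running time is at most $c\,(|\Sigma|+|\mathsf{Pref}(\mathcal P)|+n)^c$. -/

import Mathlib

namespace DFALearning

/-! ### Automata and the learning task -/

/-- A DFA over the alphabet `α`: a finite type of states together with a Mathlib `DFA` on it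
(the initial state makes the type of states non-empty). -/
structure FinDFA (α : Type) where
  State : Type
  [fintypeState : Fintype State]
  toDFA : DFA α State

attribute [instance] FinDFA.fintypeState

variable {α : Type}

/-- The number of states. -/
def FinDFA.size (A : FinDFA α) : ℕ := Fintype.card A.State

/-- The accepted words. -/
def FinDFA.lang (A : FinDFA α) : Set (List α) := {w | w ∈ A.toDFA.accepts}

/-- The number of accepted words of length at most `h` (the alphabet will be finite). -/
noncomputable def FinDFA.count (A : FinDFA α) (h : ℕ) : ℕ :=
  {w : List α | w ∈ A.lang ∧ w.length ≤ h}.ncard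

/-- The DFAs with at most `n` states that accept all words of `P`. -/
def Rec (P : Set (List α)) (n : ℕ) : Set (FinDFA α) :=
  {A | A.size ≤ n ∧ P ⊆ A.lang}

/-- The order `≺_h`: `A` accepts fewer words of length at most `h` than `B`. -/
def CountLT (h : ℕ) (A B : FinDFA α) : Prop := A.count h < B.count h

/-- `A` belongs to `S` and no element of `S` is below `A`. -/
def IsMinimalIn (S : Set (FinDFA α)) (r : FinDFA α → FinDFA α → Prop) (A : FinDFA α) : Prop :=
  A ∈ S ∧ ∀ B ∈ S, ¬ r B A

/-- `A` is a solution of the word-counting learning task for the positive words `P` and the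
bound `n` on the number of states. -/
def SolvesTask (P : Set (List α)) (n : ℕ) (A : FinDFA α) : Prop :=
  IsMinimalIn (Rec P n) (CountLT (2 * n - 2)) A

/-- The set of prefixes of words of `P`. -/
def Pref (P : Set (List α)) : Set (List α) := {u | ∃ w ∈ P, u <+: w}

/-! ### Propositional formulas and SAT solvers -/

/-- Formulas in conjunctive normal form. A formula is a list of clauses, a clause is a list of
literals, and the literal `(i, b)` says that the variable `i` has the value `b`. -/
abbrev Cnf : Type := List (List (ℕ × Bool))

/-- The valuation `v` satisfies the formula `φ`. -/
def Cnf.Sat (v : ℕ → Bool) (φ : Cnf) : Prop := ∀ C ∈ φ, ∃ l ∈ C, v l.1 = l.2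

/-- All variables that occur in `φ` are smaller than `φ.numVars`, and it is the least such
number. -/
def Cnf.numVars (φ : Cnf) : ℕ := (φ.flatten.map fun l => l.1 + 1).foldr max 0

/-- A SAT solver: it returns a satisfying valuation of each satisfiable formula, and reports
that there is none for the others. -/
structure SatSolver where
  solve : Cnf → Option (ℕ → Bool)
  sound : ∀ φ v, solve φ = some v → Cnf.Sat v φ
  complete : ∀ φ, solve φ = none → ∀ v, ¬ Cnf.Sat v φ

/-! ### Data and their encodings -/

/-- The data on which programs compute: binary trees. -/
inductive Data : Type
  | nil : Data
  | cons : Data → Data → Data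

/-- The number of nodes. -/
def Data.size : Data → ℕ
  | .nil => 1
  | .cons a b => 1 + a.size + b.size

def Data.hd : Data → Data
  | .nil => .nil
  | .cons a _ => a

def Data.tl : Data → Data
  | .nil => .nil
  | .cons _ b => b

/-- Lists as data. -/
def encList {β : Type} (f : β → Data) : List β → Data
  | [] => .nil
  | b :: l => .cons (f b) (encList f l)

/-- Natural numbers, in unary. -/
def encNat : ℕ → Data
  | 0 => .nil
  | k + 1 => .cons .nil (encNat k)

def encBool : Bool → Data
  | false => .nil
  | true => .cons .nil .nil

def encCnf (φ : Cnf) : Data :=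
  encList (encList fun l : ℕ × Bool => .cons (encBool l.2) (encNat l.1)) φ

/-- The size of a formula, as the input of a SAT solver. -/
def Cnf.size (φ : Cnf) : ℕ := (encCnf φ).size

/-- The answer of a SAT solver to the query `φ`, as it is handed to the program: `nil` for
`unsatisfiable`, otherwise the list of the values of the variables `0, …, φ.numVars - 1`. -/
def encAnswer (φ : Cnf) : Option (ℕ → Bool) → Data
  | none => .nil
  | some v => .cons .nil (encList encBool ((List.range φ.numVars).map v))

/-- The input of the learning task: the number of letters, the bound on the number of states,
and a list of the positive words. -/
def encInput (m n : ℕ) (l : List (List (Fin m))) : Data :=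
  .cons (encNat m) (.cons (encNat n) (encList (encList fun a : Fin m => encNat a) l))

open Classical in
/-- A DFA with states `0, …, s - 1`: its initial state, its transition table (one row for each
state, with one entry for each letter), and the list of truth values that says which states
are final. -/
noncomputable def encDFA {m s : ℕ} (A : DFA (Fin m) (Fin s)) : Data :=
  .cons (encNat A.start)
    (.cons
      (encList (fun q : Fin s => encList (fun a : Fin m => encNat (A.step q a)) (List.finRange m))
        (List.finRange s))
      (encList (fun q : Fin s => encBool (decide (q ∈ A.accept))) (List.finRange s)))

/-! ### Programs that call a SAT solver -/

/-- Programs of a small WHILE language over binary trees; each program transforms one datum.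
A test asks whether the head of the current datum is different from `nil`. -/
inductive Prog : Type
  | id : Prog
  | nil : Prog
  | hd : Prog
  | tl : Prog
  /-- run both programs on the current datum, and pair the results -/
  | pair : Prog → Prog → Prog
  /-- run the first program, then the second one on the result -/
  | seq : Prog → Prog → Prog
  /-- run the first program if the test succeeds, and the second one otherwise -/
  | cond : Prog → Prog → Prog
  /-- run the program repeatedly, as long as the test succeeds -/
  | loop : Prog → Prog
  /-- call the SAT solver on the formula encoded by the current datum -/
  | ask : Prog

/-- `Run S p x y t qs`: with the SAT solver `S`, the program `p` halts on the input `x` with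
output `y`, in time `t`, and `qs` is the list of formulas on which it calls the solver (in order,
with repetitions). Every instruction costs one unit plus the size of the datum
to which it is applied; a call of the solver costs in addition the size of the answer, but the
work of the solver is not counted. -/
inductive Run (S : SatSolver) : Prog → Data → Data → ℕ → List Cnf → Prop
  | id (x : Data) : Run S .id x x (1 + x.size) []
  | nil (x : Data) : Run S .nil x .nil (1 + x.size) []
  | hd (x : Data) : Run S .hd x x.hd (1 + x.size) []
  | tl (x : Data) : Run S .tl x x.tl (1 + x.size) []
  | pair {p q : Prog} {x y z : Data} {t u : ℕ} {ps qs : List Cnf}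
      (hp : Run S p x y t ps) (hq : Run S q x z u qs) :
      Run S (.pair p q) x (.cons y z) (1 + x.size + t + u) (ps ++ qs)
  | seq {p q : Prog} {x y z : Data} {t u : ℕ} {ps qs : List Cnf}
      (hp : Run S p x y t ps) (hq : Run S q y z u qs) :
      Run S (.seq p q) x z (1 + x.size + t + u) (ps ++ qs)
  | condTrue {p q : Prog} {x y : Data} {t : ℕ} {ps : List Cnf}
      (hx : x.hd ≠ .nil) (hp : Run S p x y t ps) :
      Run S (.cond p q) x y (1 + x.size + t) ps
  | condFalse {p q : Prog} {x y : Data} {t : ℕ} {qs : List Cnf}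
      (hx : x.hd = .nil) (hq : Run S q x y t qs) :
      Run S (.cond p q) x y (1 + x.size + t) qs
  | loopStop {p : Prog} {x : Data} (hx : x.hd = .nil) :
      Run S (.loop p) x x (1 + x.size) []
  | loopStep {p : Prog} {x y z : Data} {t u : ℕ} {ps qs : List Cnf}
      (hx : x.hd ≠ .nil) (hp : Run S p x y t ps) (hq : Run S (.loop p) y z u qs) :
      Run S (.loop p) x z (1 + x.size + t + u) (ps ++ qs)
  | ask (φ : Cnf) :
      Run S .ask (encCnf φ) (encAnswer φ (S.solve φ))
        (1 + (encCnf φ).size + (encAnswer φ (S.solve φ)).size) [φ]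

end DFALearning

/-!
Let `μ` be the least number of words of length less than `r = 2 n - 1` that an automaton of
`Rec(P, n)` accepts. The bits of `μ` are found one at a time, the most significant one first: once
the high bits of `μ` are known, the next one is `0` if and only if some automaton of `Rec(P, n)` has
a count that starts with these bits followed by `0`, and this is one query to the solver. The last
model that the solver returned describes an automaton whose count has the same bits as `μ`.

If there are `m` letters, then the count is at most `1 + m + ⋯ + m ^ (r - 1)`, and the number `b` of
bits of this sum satisfies `2 ^ b ≤ m ^ r` if `m ≥ 2`, hence `b ≤ (2 n - 1) log₂ m`.

The query has polynomial size although the count may be exponential in `n`: the number of words of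
length less than `i + 1` accepted from a state `q` is a sum over the letters `a` of the numbers of
words of length less than `i` accepted from `δ(q, a)`, plus one if `q` is final, and a formula can
perform these additions in binary with ripple-carry adders, layer by layer in `i`.
-/

namespace DFALearning

open Polynomial

/-! ### Polynomial bounds -/

theorem eval_mono (P : ℕ[X]) : Monotone P.eval := fun a b h => by
  simp only [eval_eq_sum_range]
  gcongr

theorem exists_eval_le_mul_pow (P : ℕ[X]) : ∃ c : ℕ, ∀ x, 1 ≤ x → P.eval x ≤ c * x ^ c := by
  refine ⟨P.eval 1 + P.natDegree, fun x hx => ?_⟩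
  calc P.eval x = ∑ i ∈ Finset.range (P.natDegree + 1), P.coeff i * x ^ i := eval_eq_sum_range x
    _ ≤ ∑ i ∈ Finset.range (P.natDegree + 1), P.coeff i * x ^ P.natDegree := by
        gcongr with i hi
        exact Finset.mem_range_succ_iff.1 hi
    _ = P.eval 1 * x ^ P.natDegree := by simp [← Finset.sum_mul, eval_eq_sum_range]
    _ ≤ (P.eval 1 + P.natDegree) * x ^ (P.eval 1 + P.natDegree) := by gcongr <;> omega

theorem mul_pow_self_mono {c d x : ℕ} (h : c ≤ d) (hx : 1 ≤ x) : c * x ^ c ≤ d * x ^ d := by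
  gcongr

/-! ### Encodings -/

/-- A type whose elements are encoded as data. The encodings of lists, numbers and truth values
are those of the statement. -/
class Enc (α : Type) where
  enc : α → Data

open Enc

instance : Enc Unit := ⟨fun _ => .nil⟩
instance : Enc Bool := ⟨encBool⟩
instance : Enc ℕ := ⟨encNat⟩
instance {α : Type} [Enc α] : Enc (List α) := ⟨encList enc⟩
instance {α β : Type} [Enc α] [Enc β] : Enc (α × β) := ⟨fun x => .cons (enc x.1) (enc x.2)⟩
instance {α : Type} [Enc α] : Enc (Option α) :=
  ⟨fun | none => .nil | some a => .cons .nil (enc a)⟩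

/-- The number of nodes of the encoding of `x`, the measure in which running times are bounded. -/
def esize {α : Type} [Enc α] (x : α) : ℕ := (enc x).size

theorem Data.size_pos (x : Data) : 1 ≤ x.size := by
  cases x <;> simp only [Data.size] <;> omega

section
variable {α β : Type} [Enc α] [Enc β]

@[simp] theorem enc_nil : enc ([] : List α) = .nil := rfl
@[simp] theorem enc_cons (a : α) (l : List α) : enc (a :: l) = .cons (enc a) (enc l) := rfl
@[simp] theorem enc_pair (a : α) (b : β) : enc (a, b) = .cons (enc a) (enc b) := rfl
@[simp] theorem enc_false : enc false = .nil := rfl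
@[simp] theorem enc_true : enc true = .cons .nil .nil := rfl
@[simp] theorem enc_zero : enc 0 = .nil := rfl
@[simp] theorem enc_succ (k : ℕ) : enc (k + 1) = .cons .nil (enc k) := rfl
@[simp] theorem enc_none : enc (none : Option α) = .nil := rfl

theorem encList_map {δ γ : Type} (F : γ → Data) (f : δ → γ) (l : List δ) :
    encList F (l.map f) = encList (fun c => F (f c)) l := by
  induction l with
  | nil => rfl
  | cons c l ih => rw [List.map_cons, encList, ih, encList]

theorem encList_eq_enc_map {γ : Type} {F : γ → Data} {f : γ → α} (h : ∀ c, F c = enc (f c))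
    (l : List γ) : encList F l = enc (l.map f) :=
  funext h ▸ (encList_map enc f l).symm

theorem esize_pos (x : α) : 1 ≤ esize x := Data.size_pos _

theorem esize_pair (a : α) (b : β) : esize (a, b) = 1 + esize a + esize b := rfl
theorem esize_nil : esize ([] : List α) = 1 := rfl
theorem esize_cons (a : α) (l : List α) : esize (a :: l) = 1 + esize a + esize l := rfl

theorem esize_nat (k : ℕ) : esize k = 2 * k + 1 := by
  induction k with
  | zero => rfl
  | succ k ih =>
    have : esize (k + 1) = 1 + 1 + esize k := rfl
    omega

theorem esize_bool_le (b : Bool) : esize b ≤ 3 := by cases b <;> decide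

theorem esize_append (l₁ l₂ : List α) : esize (l₁ ++ l₂) + 1 = esize l₁ + esize l₂ := by
  induction l₁ with
  | nil => simp only [List.nil_append, esize_nil, add_comm]
  | cons a l ih => simp only [List.cons_append, esize_cons]; omega

theorem esize_reverse (l : List α) : esize l.reverse = esize l := by
  induction l with
  | nil => rfl
  | cons a l ih =>
    have := esize_append l.reverse [a]
    simp only [List.reverse_cons, esize_cons, esize_nil] at *
    omega

theorem esize_le_of_forall_mem {l : List α} {M : ℕ} (h : ∀ a ∈ l, esize a ≤ M) :
    esize l ≤ 1 + l.length * (1 + M) := by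
  induction l with
  | nil => simp [esize_nil]
  | cons a l ih =>
    obtain ⟨ha, hl⟩ := List.forall_mem_cons.1 h
    have := ih hl
    simp only [esize_cons, List.length_cons, add_mul] at *
    omega

theorem length_le_esize (l : List α) : l.length ≤ esize l := by
  induction l with
  | nil => simp
  | cons a l ih => simp only [esize_cons, List.length_cons]; omega

theorem esize_le_of_mem {l : List α} {a : α} (h : a ∈ l) : esize a ≤ esize l := by
  obtain ⟨l₁, l₂, rfl⟩ := List.append_of_mem h
  have := esize_append l₁ (a :: l₂)
  have := esize_pos l₁
  rw [esize_cons] at *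
  omega

theorem esize_le_of_isPrefix {l₁ l₂ : List α} (h : l₁ <+: l₂) : esize l₁ ≤ esize l₂ := by
  obtain ⟨l, rfl⟩ := h
  have := esize_append l₁ l
  have := esize_pos l
  omega

theorem esize_le_of_isSuffix {l₁ l₂ : List α} (h : l₁ <:+ l₂) : esize l₁ ≤ esize l₂ := by
  obtain ⟨l, rfl⟩ := h
  have := esize_append l l₁
  have := esize_pos l
  omega

theorem esize_flatMap_le {γ : Type} {f : γ → List α} {l : List γ} {M : ℕ}
    (h : ∀ c ∈ l, esize (f c) ≤ M) :
    esize (l.flatMap f) ≤ 1 + l.length * M := by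
  induction l with
  | nil => simp [esize_nil]
  | cons c l ih =>
    obtain ⟨hc, hl⟩ := List.forall_mem_cons.1 h
    have := ih hl
    have := esize_append (f c) (l.flatMap f)
    simp only [List.flatMap_cons, List.length_cons, add_mul] at *
    omega

end

/-! ### Functions computable in polynomial time -/

theorem Run.size_le {S : SatSolver} {p : Prog} {x y : Data} {t : ℕ} {qs : List Cnf}
    (h : Run S p x y t qs) : y.size ≤ t := by
  induction h with
  | nil x => simp [Data.size]
  | hd x => cases x <;> simp only [Data.size, Data.hd] <;> omega
  | tl x => cases x <;> simp only [Data.size, Data.tl] <;> omega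
  | pair _ _ ih₁ ih₂ => simp only [Data.size]; omega
  | _ => omega

instance : Nonempty SatSolver := by
  classical
  refine ⟨⟨fun φ => if h : ∃ v, Cnf.Sat v φ then some h.choose else none, ?_, ?_⟩⟩
  · intro φ v h
    split_ifs at h with hsat
    exact Option.some.inj h ▸ hsat.choose_spec
  · intro φ h v hv
    rw [dif_pos ⟨v, hv⟩] at h
    contradiction

/-- `f` is computed in polynomial time by a program that does not call the solver. -/
@[fun_prop]
def PolyTime {α β : Type} [Enc α] [Enc β] (f : α → β) : Prop :=
  ∃ (p : Prog) (P : ℕ[X]), ∀ (S : SatSolver) (x : α),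
    ∃ t, Run S p (enc x) (enc (f x)) t [] ∧ t ≤ P.eval (esize x)

/-- `f` is bounded by a polynomial in the size of the encoding of its argument. -/
@[fun_prop]
def PolyBounded {α : Type} [Enc α] (f : α → ℕ) : Prop :=
  ∃ P : ℕ[X], ∀ x, f x ≤ P.eval (esize x)

section
variable {α β γ : Type} [Enc α] [Enc β] [Enc γ]

@[fun_prop]
theorem PolyBounded.const (c : ℕ) : PolyBounded fun _ : α => c := ⟨C c, fun x => by simp⟩

@[fun_prop]
theorem PolyBounded.add {f g : α → ℕ} (hf : PolyBounded f) (hg : PolyBounded g) :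
    PolyBounded fun x => f x + g x := by
  obtain ⟨P, hP⟩ := hf
  obtain ⟨Q, hQ⟩ := hg
  exact ⟨P + Q, fun x => by rw [eval_add]; exact add_le_add (hP x) (hQ x)⟩

@[fun_prop]
theorem PolyBounded.mul {f g : α → ℕ} (hf : PolyBounded f) (hg : PolyBounded g) :
    PolyBounded fun x => f x * g x := by
  obtain ⟨P, hP⟩ := hf
  obtain ⟨Q, hQ⟩ := hg
  exact ⟨P * Q, fun x => by rw [eval_mul]; exact Nat.mul_le_mul (hP x) (hQ x)⟩

@[fun_prop]
theorem PolyBounded.eval {f : α → ℕ} (hf : PolyBounded f) (P : ℕ[X]) :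
    PolyBounded fun x => P.eval (f x) := by
  obtain ⟨Q, hQ⟩ := hf
  exact ⟨P.comp Q, fun x => by rw [eval_comp]; exact eval_mono P (hQ x)⟩

@[fun_prop]
theorem PolyBounded.esize {f : α → β} (hf : PolyTime f) : PolyBounded fun x => esize (f x) := by
  obtain ⟨p, P, h⟩ := hf
  refine ⟨P, fun x => ?_⟩
  obtain ⟨t, ht, hle⟩ := h (Classical.arbitrary SatSolver) x
  exact ht.size_le.trans hle

theorem PolyTime.of_bound {f : α → β} (p : Prog) {b : α → ℕ} (hb : PolyBounded b)
    (h : ∀ (S : SatSolver) x, ∃ t, Run S p (enc x) (enc (f x)) t [] ∧ t ≤ b x) : PolyTime f := by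
  obtain ⟨P, hP⟩ := hb
  exact ⟨p, P, fun S x => (h S x).imp fun t ht => ⟨ht.1, ht.2.trans (hP x)⟩⟩

theorem PolyTime.of_enc_eq {f : α → β} (h : ∀ x, enc (f x) = enc x) : PolyTime f :=
  ⟨.id, 1 + X, fun S x => ⟨_, by rw [h]; exact .id _, by simp [esize]⟩⟩

theorem PolyTime.of_enc_eq_hd {f : α → β} (h : ∀ x, enc (f x) = (enc x).hd) : PolyTime f :=
  ⟨.hd, 1 + X, fun S x => ⟨_, by rw [h]; exact .hd _, by simp [esize]⟩⟩

theorem PolyTime.of_enc_eq_tl {f : α → β} (h : ∀ x, enc (f x) = (enc x).tl) : PolyTime f :=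
  ⟨.tl, 1 + X, fun S x => ⟨_, by rw [h]; exact .tl _, by simp [esize]⟩⟩

theorem PolyTime.of_enc_eq_enc {f : α → β} {g : α → γ} (hg : PolyTime g)
    (h : ∀ x, enc (f x) = enc (g x)) : PolyTime f := by
  obtain ⟨p, P, hp⟩ := hg
  exact ⟨p, P, fun S x => by rw [h]; exact hp S x⟩

theorem PolyTime.congr {f g : α → β} (hg : PolyTime g) (h : ∀ x, f x = g x) : PolyTime f :=
  hg.of_enc_eq_enc fun x => by rw [h]

@[fun_prop]
theorem PolyTime.id : PolyTime fun x : α => x := .of_enc_eq fun _ => rfl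

@[fun_prop]
theorem PolyTime.comp {g : β → γ} {f : α → β} (hg : PolyTime g) (hf : PolyTime f) :
    PolyTime fun x => g (f x) := by
  obtain ⟨q, Q, hq⟩ := hg
  have ⟨p, P, hp⟩ := hf
  refine .of_bound (.seq p q) (b := fun x => 1 + esize x + P.eval (esize x) + Q.eval (esize (f x)))
    (by fun_prop) fun S x => ?_
  obtain ⟨t, ht, htP⟩ := hp S x
  obtain ⟨u, hu, huQ⟩ := hq S (f x)
  exact ⟨_, .seq ht hu, by simp only [esize] at *; omega⟩

@[fun_prop]
theorem PolyTime.prodMk {f : α → β} {g : α → γ} (hf : PolyTime f) (hg : PolyTime g) :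
    PolyTime fun x => (f x, g x) := by
  obtain ⟨p, P, hp⟩ := hf
  obtain ⟨q, Q, hq⟩ := hg
  refine .of_bound (.pair p q) (b := fun x => 1 + esize x + P.eval (esize x) + Q.eval (esize x))
    (by fun_prop) fun S x => ?_
  obtain ⟨t, ht, htP⟩ := hp S x
  obtain ⟨u, hu, huQ⟩ := hq S x
  exact ⟨_, .pair ht hu, by simp only [esize] at *; omega⟩

@[fun_prop]
theorem PolyTime.fst : PolyTime (Prod.fst : α × β → α) := .of_enc_eq_hd fun _ => rfl

@[fun_prop]
theorem PolyTime.snd : PolyTime (Prod.snd : α × β → β) := .of_enc_eq_tl fun _ => rfl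

theorem exists_const_prog (d : Data) :
    ∃ (p : Prog) (P : ℕ[X]), ∀ (S : SatSolver) (x : Data),
      ∃ t, Run S p x d t [] ∧ t ≤ P.eval x.size := by
  induction d with
  | nil => exact ⟨.nil, 1 + X, fun S x => ⟨_, .nil x, by simp⟩⟩
  | cons a b iha ihb =>
    obtain ⟨p, P, hp⟩ := iha
    obtain ⟨q, Q, hq⟩ := ihb
    refine ⟨.pair p q, 1 + X + P + Q, fun S x => ?_⟩
    obtain ⟨t, ht, htP⟩ := hp S x
    obtain ⟨u, hu, huQ⟩ := hq S x
    refine ⟨_, .pair ht hu, ?_⟩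
    simp only [eval_add, eval_X, eval_one]
    omega

@[fun_prop]
theorem PolyTime.const (b : β) : PolyTime fun _ : α => b := by
  obtain ⟨p, P, hp⟩ := exists_const_prog (enc b)
  exact ⟨p, P, fun S x => hp S (enc x)⟩

theorem PolyTime.of_hd_eq_nil {f g h : α → β} (hf : PolyTime f) (hg : PolyTime g)
    (hhf : ∀ x, (enc x).hd ≠ .nil → h x = f x) (hhg : ∀ x, (enc x).hd = .nil → h x = g x) :
    PolyTime h := by
  obtain ⟨p, P, hp⟩ := hf
  obtain ⟨q, Q, hq⟩ := hg
  refine .of_bound (.cond p q) (b := fun x => 1 + esize x + P.eval (esize x) + Q.eval (esize x))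
    (by fun_prop) fun S x => ?_
  obtain ⟨t, ht, htP⟩ := hp S x
  obtain ⟨u, hu, huQ⟩ := hq S x
  by_cases hx : (enc x).hd = .nil
  · rw [hhg x hx]
    exact ⟨_, .condFalse hx hu, by simp only [esize] at *; omega⟩
  · rw [hhf x hx]
    exact ⟨_, .condTrue hx ht, by simp only [esize] at *; omega⟩

@[fun_prop]
theorem PolyTime.cond {c : α → Bool} {f g : α → β} (hc : PolyTime c) (hf : PolyTime f)
    (hg : PolyTime g) : PolyTime fun x => bif c x then f x else g x := by
  have key : PolyTime fun y : Bool × α => bif y.1 then f y.2 else g y.2 := by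
    refine .of_hd_eq_nil (hf.comp .snd) (hg.comp .snd) ?_ ?_ <;> rintro ⟨b, x⟩ <;>
      cases b <;> simp [Data.hd]
  exact key.comp (hc.prodMk .id)

@[fun_prop]
theorem PolyTime.not {c : α → Bool} (hc : PolyTime c) : PolyTime fun x => !c x :=
  (hc.cond (.const false) (.const true)).congr fun x => by cases c x <;> rfl

@[fun_prop]
theorem PolyTime.or {c d : α → Bool} (hc : PolyTime c) (hd : PolyTime d) :
    PolyTime fun x => c x || d x :=
  (hc.cond (.const true) hd).congr fun x => by cases c x <;> rfl

end

/-! ### Recursion on lists and numbers -/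

section
variable {α β γ : Type} [Enc α] [Enc β] [Enc γ]

theorem Run.exists_loop_foldl {S : SatSolver} {p : Prog} {P : ℕ[X]} {s : β → γ → β} {x : α}
    {M : ℕ} (hp : ∀ (c : γ) (l : List γ) (y : β), ∃ t,
      Run S p (enc (c :: l, y, x)) (enc (l, s y c, x)) t [] ∧ t ≤ P.eval (esize (c :: l, y, x)))
    (l : List γ) (y : β) (hM : ∀ l₁ l₂, l₁ ++ l₂ = l → esize (l₂, l₁.foldl s y, x) ≤ M) :
    ∃ t, Run S (.loop p) (enc (l, y, x)) (enc (([] : List γ), l.foldl s y, x)) t [] ∧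
      t ≤ (l.length + 1) * (1 + M + P.eval M) := by
  induction l generalizing y with
  | nil =>
    refine ⟨_, .loopStop rfl, ?_⟩
    have : esize (([] : List γ), y, x) ≤ M := hM [] [] rfl
    simp only [esize, List.length_nil, zero_add, one_mul] at *
    omega
  | cons c l ih =>
    obtain ⟨t, hrun, ht⟩ := hp c l y
    obtain ⟨u, hloop, hu⟩ := ih (s y c) fun l₁ l₂ h => hM (c :: l₁) l₂ (by rw [← h]; rfl)
    refine ⟨_, .loopStep (by simp [Data.hd]) hrun hloop, ?_⟩
    have hsize : esize (c :: l, y, x) ≤ M := hM [] _ rfl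
    have := eval_mono P hsize
    rw [List.length_cons, add_mul _ 1, one_mul]
    simp only [esize] at *
    omega

theorem PolyTime.foldl_of_bound {l : α → List γ} {i : α → β} {s : α → β → γ → β}
    (hl : PolyTime l) (hi : PolyTime i) (hs : PolyTime fun p : α × β × γ => s p.1 p.2.1 p.2.2)
    {b : α → ℕ} (hb : PolyBounded b)
    (h : ∀ x l₁, l₁ <+: l x → esize (l₁.foldl (s x) (i x)) ≤ b x) :
    PolyTime fun x => (l x).foldl (s x) (i x) := by
  have hround : PolyTime fun y : (γ × List γ) × β × α => (y.1.2, s y.2.2 y.2.1 y.1.1, y.2.2) :=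
    (PolyTime.snd.comp .fst).prodMk ((hs.comp (f := fun y : (γ × List γ) × β × α =>
      (y.2.2, y.2.1, y.1.1)) (by fun_prop)).prodMk (PolyTime.snd.comp .snd))
  have hinit : PolyTime fun x => (l x, i x, x) := by fun_prop
  obtain ⟨p, P, hp⟩ := hround
  have ⟨q, Q, hq⟩ := hinit
  let M x := 2 + esize (l x) + b x + esize x
  have hM : PolyBounded M := by fun_prop
  have hfinal : PolyTime fun x => (([] : List γ), (l x).foldl (s x) (i x), x) := by
    refine .of_bound (.seq q (.loop p)) (b := fun x => 1 + esize x + Q.eval (esize x) +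
      (esize (l x) + 1) * (1 + M x + P.eval (M x))) (by fun_prop) fun S x => ?_
    obtain ⟨t, hinit, ht⟩ := hq S x
    obtain ⟨u, hloop, hu⟩ := Run.exists_loop_foldl (P := P) (s := s x) (x := x) (M := M x)
      (fun c l y => hp S ((c, l), y, x)) (l x) (i x) fun l₁ l₂ h₁₂ => by
        have := h x l₁ ⟨l₂, h₁₂⟩
        have := esize_le_of_isSuffix ⟨l₁, h₁₂⟩
        simp only [M, esize_pair]
        omega
    have hlength : ((l x).length + 1) * (1 + M x + P.eval (M x)) ≤
        (esize (l x) + 1) * (1 + M x + P.eval (M x)) := by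
      gcongr
      exact length_le_esize _
    exact ⟨_, .seq hinit hloop, by simp only [esize] at *; omega⟩
  exact (PolyTime.fst.comp .snd).comp hfinal

theorem PolyTime.iterate_of_bound {k : α → ℕ} {i : α → β} {s : α → β → β}
    (hk : PolyTime k) (hi : PolyTime i) (hs : PolyTime fun p : α × β => s p.1 p.2)
    {b : α → ℕ} (hb : PolyBounded b) (h : ∀ x, ∀ j ≤ k x, esize ((s x)^[j] (i x)) ≤ b x) :
    PolyTime fun x => (s x)^[k x] (i x) := by
  have hunary : PolyTime fun x => List.replicate (k x) () :=
    hk.of_enc_eq_enc fun x => by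
      induction k x with
      | zero => rfl
      | succ k ih => rw [List.replicate_succ, enc_cons, ih]; rfl
  refine (hunary.foldl_of_bound (s := fun x y _ => s x y) hi
    (hs.comp (f := fun p : α × β × Unit => (p.1, p.2.1)) (by fun_prop)) hb
    fun x l₁ hl₁ => ?_).congr fun x => by rw [List.foldl_const, List.length_replicate]
  rw [List.foldl_const]
  exact h x _ (by simpa using hl₁.length_le)

/-! ### Operations on lists -/

@[fun_prop]
theorem PolyTime.cons {f : α → β} {g : α → List β} (hf : PolyTime f) (hg : PolyTime g) :
    PolyTime fun x => f x :: g x :=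
  (hf.prodMk hg).of_enc_eq_enc fun _ => rfl

@[fun_prop]
theorem PolyTime.tail : PolyTime (List.tail : List α → List α) :=
  .of_enc_eq_tl fun l => by cases l <;> rfl

@[fun_prop]
theorem PolyTime.headD {f : α → List β} {g : α → β} (hf : PolyTime f) (hg : PolyTime g) :
    PolyTime fun x => (f x).headD (g x) := by
  have key : PolyTime fun y : List β × β => y.1.headD y.2 := by
    refine .of_bound (.cond (.seq .hd .hd) .tl) (b := fun y => 5 + 5 * esize y)
      (by fun_prop) fun S y => ?_
    obtain ⟨_ | ⟨a, l⟩, d⟩ := y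
    · exact ⟨_, .condFalse rfl (.tl _), by simp only [esize]; omega⟩
    · refine ⟨_, .condTrue (by simp [Data.hd]) (.seq (.hd _) (.hd _)), ?_⟩
      simp only [esize, enc_pair, enc_cons, Data.hd, Data.size]
      omega
  exact key.comp (hf.prodMk hg)

@[fun_prop]
theorem PolyTime.reverse {f : α → List β} (hf : PolyTime f) : PolyTime fun x => (f x).reverse := by
  refine (hf.foldl_of_bound (s := fun _ l b => b :: l) (.const []) (by fun_prop)
    (b := fun x => esize (f x)) (by fun_prop) fun x l₁ hl₁ => ?_).congr fun x => by simp
  rw [List.foldl_flip_cons_eq_append', List.append_nil, esize_reverse]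
  exact esize_le_of_isPrefix hl₁

@[fun_prop]
theorem PolyTime.append {f g : α → List β} (hf : PolyTime f) (hg : PolyTime g) :
    PolyTime fun x => f x ++ g x := by
  refine (hf.reverse.foldl_of_bound (s := fun _ l b => b :: l) hg (by fun_prop)
    (b := fun x => esize (f x) + esize (g x)) (by fun_prop) fun x l₁ hl₁ => ?_).congr
    fun x => by simp
  rw [List.foldl_flip_cons_eq_append']
  have := esize_append l₁.reverse (g x)
  have := esize_le_of_isPrefix hl₁
  rw [esize_reverse] at *
  omega

@[fun_prop]
theorem PolyTime.flatMap {l : α → List γ} {f : α → γ → List β} (hl : PolyTime l)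
    (hf : PolyTime fun p : α × γ => f p.1 p.2) : PolyTime fun x => (l x).flatMap (f x) := by
  obtain ⟨P, hP⟩ := PolyBounded.esize hf
  refine (hl.foldl_of_bound (s := fun x acc c => acc ++ f x c) (.const [])
    ((PolyTime.fst.comp .snd).append (hf.comp (PolyTime.fst.prodMk (PolyTime.snd.comp .snd))))
    (b := fun x => 1 + esize (l x) * P.eval (1 + esize x + esize (l x))) (by fun_prop)
    fun x l₁ hl₁ => ?_).congr fun x => by
      rw [List.foldl_append_eq_append, List.nil_append, List.flatMap_def]
  have hvalue : ∀ c ∈ l₁, esize (f x c) ≤ P.eval (1 + esize x + esize (l x)) := fun c hc =>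
    (hP (x, c)).trans (eval_mono P (by
      have := esize_le_of_mem (hl₁.subset hc)
      rw [esize_pair]
      omega))
  rw [List.foldl_append_eq_append, List.nil_append]
  refine (esize_flatMap_le hvalue).trans ?_
  gcongr
  exact hl₁.length_le.trans (length_le_esize _)

@[fun_prop]
theorem PolyTime.map {l : α → List γ} {f : α → γ → β} (hl : PolyTime l)
    (hf : PolyTime fun p : α × γ => f p.1 p.2) : PolyTime fun x => (l x).map (f x) :=
  (hl.flatMap (f := fun x c => [f x c]) (hf.cons (.const []))).congr fun x => by
    rw [List.map_eq_flatMap]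

@[fun_prop]
theorem PolyTime.filter {l : α → List γ} {f : α → γ → Bool} (hl : PolyTime l)
    (hf : PolyTime fun p : α × γ => f p.1 p.2) : PolyTime fun x => (l x).filter (f x) :=
  (hl.flatMap (f := fun x c => bif f x c then [c] else []) (hf.cond (by fun_prop)
    (.const []))).congr fun x => by
    induction l x with
    | nil => rfl
    | cons c l ih => rw [List.flatMap_cons, ← ih, List.filter_cons]; cases f x c <;> rfl

/-! ### Operations on numbers -/

@[fun_prop]
theorem PolyTime.length {f : α → List β} (hf : PolyTime f) : PolyTime fun x => (f x).length :=
  (hf.map (f := fun _ _ => ()) (.const ())).of_enc_eq_enc fun x => by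
    induction f x with
    | nil => rfl
    | cons b l ih => rw [List.map_cons, enc_cons, ← ih]; rfl

@[fun_prop]
theorem PolyTime.succ : PolyTime Nat.succ :=
  ((PolyTime.const ()).prodMk .id).of_enc_eq_enc fun _ => rfl

@[fun_prop]
theorem PolyTime.pred : PolyTime Nat.pred := .of_enc_eq_tl fun k => by cases k <;> rfl

@[fun_prop]
theorem PolyTime.add {f g : α → ℕ} (hf : PolyTime f) (hg : PolyTime g) :
    PolyTime fun x => f x + g x := by
  refine (hg.iterate_of_bound (s := fun _ => Nat.succ) hf (PolyTime.succ.comp .snd)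
    (b := fun x => esize (f x) + esize (g x)) (by fun_prop) fun x j hj => ?_).congr fun x =>
    (Nat.succ_iterate _ _).symm
  rw [Nat.succ_iterate, esize_nat, esize_nat, esize_nat]
  omega

@[fun_prop]
theorem PolyTime.mul {f g : α → ℕ} (hf : PolyTime f) (hg : PolyTime g) :
    PolyTime fun x => f x * g x := by
  refine (hf.iterate_of_bound (s := fun x k => k + g x) (.const 0)
    (PolyTime.snd.add (hg.comp .fst)) (b := fun x => 1 + esize (f x) * esize (g x))
    (by fun_prop) fun x j hj => ?_).congr fun x => by simp [add_right_iterate]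
  have := Nat.mul_le_mul_right (g x) hj
  simp only [add_right_iterate, smul_eq_mul, zero_add, esize_nat]
  nlinarith

@[fun_prop]
theorem PolyTime.sub {f g : α → ℕ} (hf : PolyTime f) (hg : PolyTime g) :
    PolyTime fun x => f x - g x := by
  refine (hg.iterate_of_bound (s := fun _ => Nat.pred) hf (PolyTime.pred.comp .snd)
    (b := fun x => esize (f x)) (by fun_prop) fun x j _ => ?_).congr fun x =>
    (Nat.pred_iterate _ _).symm
  rw [Nat.pred_iterate, esize_nat, esize_nat]
  omega

@[fun_prop]
theorem PolyTime.decide_lt {f g : α → ℕ} (hf : PolyTime f) (hg : PolyTime g) :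
    PolyTime fun x => decide (f x < g x) := by
  have key : PolyTime fun y : ℕ × Unit => decide (0 < y.1) := by
    refine .of_hd_eq_nil (.const true) (.const false) ?_ ?_ <;> rintro ⟨_ | _, _⟩ <;> simp [Data.hd]
  exact (key.comp ((hg.sub hf).prodMk (.const ()))).congr fun x => by simp

@[fun_prop]
theorem PolyTime.natPair {f g : α → ℕ} (hf : PolyTime f) (hg : PolyTime g) :
    PolyTime fun x => Nat.pair (f x) (g x) := by
  have : PolyTime fun x =>
      bif decide (f x < g x) then g x * g x + f x else f x * f x + f x + g x := by fun_prop
  exact this.congr fun x => by simp [Nat.pair, Bool.cond_decide]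

@[fun_prop]
theorem PolyTime.drop {f : α → List β} {g : α → ℕ} (hf : PolyTime f) (hg : PolyTime g) :
    PolyTime fun x => (f x).drop (g x) := by
  refine (hg.iterate_of_bound (s := fun _ => List.tail) hf (PolyTime.tail.comp .snd)
    (b := fun x => esize (f x)) (by fun_prop) fun x j _ => ?_).congr fun x =>
    ((f x).tail_iterate _).symm
  rw [List.tail_iterate]
  exact esize_le_of_isSuffix (List.drop_suffix _ _)

@[fun_prop]
theorem PolyTime.getD {f : α → List β} {g : α → ℕ} {d : α → β} (hf : PolyTime f)
    (hg : PolyTime g) (hd : PolyTime d) : PolyTime fun x => (f x).getD (g x) (d x) :=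
  ((hf.drop hg).headD hd).congr fun x => by simp [List.headD_eq_head?_getD, List.head?_drop]

@[fun_prop]
theorem PolyTime.range {f : α → ℕ} (hf : PolyTime f) : PolyTime fun x => List.range (f x) := by
  have iterate_eq (k : ℕ) : (fun l : List ℕ => l ++ [l.length])^[k] [] = List.range k := by
    induction k with
    | zero => rfl
    | succ k ih => rw [Function.iterate_succ_apply', ih, List.range_succ, List.length_range]
  refine (hf.iterate_of_bound (s := fun _ l => l ++ [l.length]) (.const []) (by fun_prop)
    (b := fun x => 1 + esize (f x) * (1 + esize (f x))) (by fun_prop) fun x j hj => ?_).congr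
    fun x => (iterate_eq _).symm
  rw [iterate_eq]
  refine (esize_le_of_forall_mem (M := esize (f x)) fun a ha => ?_).trans ?_
  · have := List.mem_range.1 ha
    rw [esize_nat, esize_nat]
    omega
  · have : j ≤ esize (f x) := by rw [esize_nat]; omega
    rw [List.length_range]
    gcongr

/-! ### Operations on options -/

@[fun_prop]
theorem PolyTime.option_getD {f : α → Option (List β)} (hf : PolyTime f) :
    PolyTime fun x => (f x).getD [] := by
  have key : PolyTime fun o : Option (List β) => o.getD [] :=
    .of_enc_eq_tl fun o => by cases o <;> rfl
  exact key.comp hf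

@[fun_prop]
theorem PolyTime.isSome {f : α → Option β} (hf : PolyTime f) : PolyTime fun x => (f x).isSome := by
  have key : PolyTime fun y : Option β × Unit => y.1.isSome := by
    refine .of_hd_eq_nil (.const true) (.const false) ?_ ?_ <;> rintro ⟨_ | _, _⟩ <;> simp [Data.hd]
  exact key.comp (hf.prodMk (.const ()))

end

/-! ### The number of bits of a geometric sum -/

section
variable {α : Type} [Enc α]

theorem PolyTime.div_two_testBit_zero : PolyTime fun k : ℕ => (k / 2, k.testBit 0) := by
  have iterate_eq (k : ℕ) :
      (fun p : ℕ × Bool => (bif p.2 then p.1 + 1 else p.1, !p.2))^[k] (0, false) =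
        (k / 2, k.testBit 0) := by
    induction k with
    | zero => rfl
    | succ k ih =>
      rw [Function.iterate_succ_apply', ih]
      rcases Nat.mod_two_eq_zero_or_one k with h | h <;>
        simp only [Nat.testBit_zero, h, Prod.mk.injEq] <;> simp <;> omega
  refine (PolyTime.id.iterate_of_bound
    (s := fun _ p => (bif p.2 then p.1 + 1 else p.1, !p.2)) (.const (0, false)) (by fun_prop)
    (b := fun k => 4 + esize k) (by fun_prop) fun k j hj => ?_).congr fun k => (iterate_eq k).symm
  have := esize_bool_le (j.testBit 0)
  rw [iterate_eq, esize_pair, esize_nat, esize_nat]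
  omega

@[fun_prop]
theorem PolyTime.div_two {f : α → ℕ} (hf : PolyTime f) : PolyTime fun x => f x / 2 :=
  (PolyTime.fst.comp .div_two_testBit_zero).comp hf

@[fun_prop]
theorem PolyTime.testBit_zero {f : α → ℕ} (hf : PolyTime f) : PolyTime fun x => (f x).testBit 0 :=
  (PolyTime.snd.comp .div_two_testBit_zero).comp hf

/-- The last `w` binary digits of `x`, beginning with the lowest one. -/
def bits (w x : ℕ) : List Bool := (List.range w).map x.testBit

theorem bits_succ (w x : ℕ) : bits (w + 1) x = x.testBit 0 :: bits w (x / 2) := by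
  simp [bits, List.range_succ_eq_map, Nat.testBit_div_two]

theorem esize_bits_le (w x : ℕ) : esize (bits w x) ≤ 1 + w * 4 := by
  refine (esize_le_of_forall_mem fun b _ => esize_bool_le b).trans ?_
  simp [bits]

theorem bits_zero (w : ℕ) : bits w 0 = (List.range w).map fun _ => false :=
  List.map_congr_left fun j _ => Nat.zero_testBit j

/-- The number of binary digits of the number with the digits `l`, beginning with the lowest one;
zeros at the end of `l` do not count. -/
def numDigits (l : List Bool) : ℕ :=
  l.foldr (fun b k => bif b || decide (0 < k) then k + 1 else k) 0

theorem numDigits_le_length (l : List Bool) : numDigits l ≤ l.length := by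
  induction l with
  | nil => exact le_rfl
  | cons b l ih =>
    rw [numDigits, List.foldr_cons, ← numDigits, List.length_cons]
    cases b || decide (0 < numDigits l) <;> simp only [cond_true, cond_false] <;> omega

theorem size_eq_of_div_two (x : ℕ) : x.size =
    bif x.testBit 0 || decide (0 < (x / 2).size) then (x / 2).size + 1 else (x / 2).size := by
  rcases Nat.eq_zero_or_pos x with rfl | hx
  · rfl
  · have hsize : x.size = (x / 2).size + 1 := by
      conv_lhs => rw [← Nat.bit_testBit_zero_shiftRight_one x]
      rw [Nat.size_bit (by simpa using hx.ne'), Nat.shiftRight_one]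
    have : x.testBit 0 = true ∨ 0 < (x / 2).size := by
      rw [Nat.size_pos, Nat.testBit_zero, decide_eq_true_iff]
      omega
    rcases this with h | h <;> simp [h, hsize]

theorem numDigits_bits {w x : ℕ} (hx : x < 2 ^ w) : numDigits (bits w x) = x.size := by
  induction w generalizing x with
  | zero => simp_all [bits, numDigits]
  | succ w ih =>
    rw [bits_succ, numDigits, List.foldr_cons, ← numDigits, ih (by rw [pow_succ] at hx; omega),
      ← size_eq_of_div_two]

@[fun_prop]
theorem PolyTime.numDigits {l : α → List Bool} (hl : PolyTime l) :
    PolyTime fun x => numDigits (l x) := by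
  refine (hl.reverse.foldl_of_bound
    (s := fun _ k b => bif b || decide (0 < k) then k + 1 else k) (.const 0) (by fun_prop)
    (b := fun x => 1 + 2 * esize (l x)) (by fun_prop) fun x l₁ hl₁ => ?_).congr
    fun x => List.foldl_reverse.symm
  have hle := numDigits_le_length l₁.reverse
  rw [DFALearning.numDigits, List.foldr_reverse, List.length_reverse] at hle
  have := hle.trans (hl₁.length_le.trans (length_le_esize _))
  rw [esize_reverse] at this
  rw [esize_nat]
  omega

/-- One digit of the multiplication by `m` of a number given by its binary digits. The pair
consists of the carry and of the digits of the product found so far, beginning with the highest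
one. -/
def mulStep (m : ℕ) (p : ℕ × List Bool) (b : Bool) : ℕ × List Bool :=
  ((p.1 + bif b then m else 0) / 2, (p.1 + bif b then m else 0).testBit 0 :: p.2)

theorem foldl_mulStep_snd (m w x c : ℕ) (acc : List Bool) :
    ((bits w x).foldl (mulStep m) (c, acc)).2 = (bits w (m * x + c)).reverse ++ acc := by
  induction w generalizing x c acc with
  | zero => rfl
  | succ w ih =>
    rw [bits_succ, List.foldl_cons, mulStep, ih, bits_succ, List.reverse_cons, List.append_assoc,
      List.singleton_append]
    have hdigit : m * x + c = (c + bif x.testBit 0 then m else 0) + 2 * (m * (x / 2)) := by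
      rw [Nat.testBit_zero]
      conv_lhs => rw [← Nat.mod_add_div x 2]
      rcases Nat.mod_two_eq_zero_or_one x with h | h <;> simp only [h] <;> simp <;> ring
    have hhalf : (m * x + c) / 2 = m * (x / 2) + (c + bif x.testBit 0 then m else 0) / 2 := by omega
    have hlow : (m * x + c).testBit 0 = (c + bif x.testBit 0 then m else 0).testBit 0 := by
      generalize (c + bif x.testBit 0 then m else 0) = d at hdigit
      rw [hdigit, Nat.testBit_zero, Nat.testBit_zero, Nat.add_mul_mod_self_left]
    rw [hhalf, hlow]

theorem foldl_mulStep_fst_le {m c : ℕ} (hc : c ≤ m + 1) (l acc : List Bool) :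
    (l.foldl (mulStep m) (c, acc)).1 ≤ m + 1 := by
  induction l generalizing c acc with
  | nil => exact hc
  | cons b _ ih => exact ih (by cases b <;> simp only [cond_true, cond_false] <;> omega) _

theorem length_foldl_mulStep_snd (m : ℕ) (l : List Bool) (p : ℕ × List Bool) :
    (l.foldl (mulStep m) p).2.length = l.length + p.2.length := by
  induction l generalizing p with
  | nil => simp
  | cons b l ih => rw [List.foldl_cons, ih, mulStep, List.length_cons, List.length_cons]; omega

/-- The number of binary digits of the number of words of length less than `r` over an alphabet
with `m` letters. -/
def countBits (m r : ℕ) : ℕ := (∑ i ∈ Finset.range r, m ^ i).size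

theorem geom_sum_lt_two_pow (m r : ℕ) : ∑ i ∈ Finset.range r, m ^ i < 2 ^ ((m + 2) * r) := by
  calc ∑ i ∈ Finset.range r, m ^ i ≤ ∑ i ∈ Finset.range r, (m + 2) ^ i := by gcongr; omega
    _ < (m + 2) ^ r := Nat.geomSum_lt (by omega) fun _ => Finset.mem_range.1
    _ ≤ (2 ^ (m + 2)) ^ r := by gcongr; exact Nat.lt_two_pow_self.le
    _ = 2 ^ ((m + 2) * r) := (pow_mul _ _ _).symm

theorem countBits_le (m r : ℕ) : countBits m r ≤ (m + 2) * r :=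
  Nat.size_le.2 (geom_sum_lt_two_pow m r)

theorem two_pow_countBits_le {m : ℕ} (hm : 2 ≤ m) (r : ℕ) : 2 ^ countBits m r ≤ m ^ r := by
  obtain rfl | hm := hm.eq_or_lt
  · gcongr
    · norm_num
    · exact Nat.size_le.2 (Nat.geomSum_lt le_rfl fun _ => Finset.mem_range.1)
  · rcases hk : countBits m r with _ | k
    · exact Nat.one_le_pow _ _ (by omega)
    · calc 2 ^ (k + 1) = 2 * 2 ^ k := pow_succ' _ _
        _ ≤ (m - 1) * ∑ i ∈ Finset.range r, m ^ i :=
            Nat.mul_le_mul (by omega)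
              (Nat.lt_size.1 (by rw [← countBits, hk]; exact k.lt_succ_self))
        _ ≤ m ^ r - 1 := by rw [Nat.geomSum_eq (by omega)]; exact Nat.mul_div_le _ _
        _ ≤ m ^ r := Nat.sub_le _ _

theorem countBits_le_logb {m : ℕ} (hm : 2 ≤ m) (r : ℕ) :
    (countBits m r : ℝ) ≤ r * Real.logb 2 m := by
  have h : (2 : ℝ) ^ countBits m r ≤ (m : ℝ) ^ r := mod_cast two_pow_countBits_le hm r
  have := Real.logb_le_logb_of_le (b := 2) (by norm_num) (by positivity) h
  rwa [Real.logb_pow, Real.logb_pow, Real.logb_self_eq_one (by norm_num), mul_one] at this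

theorem iterate_mulStep_eq_bits (m w r : ℕ) :
    (fun l => (l.foldl (mulStep m) (1, [])).2.reverse)^[r] (bits w 0) =
      bits w (∑ i ∈ Finset.range r, m ^ i) := by
  induction r with
  | zero => rfl
  | succ r ih =>
    rw [Function.iterate_succ_apply', ih, foldl_mulStep_snd, List.append_nil, List.reverse_reverse,
      geom_sum_succ]

theorem PolyTime.foldl_mulStep {m : α → ℕ} {l : α → List Bool} (hm : PolyTime m)
    (hl : PolyTime l) : PolyTime fun x => (l x).foldl (mulStep (m x)) (1, []) := by
  refine hl.foldl_of_bound (.const (1, [])) (by unfold mulStep; fun_prop)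
    (b := fun x => 5 + esize (m x) + 1 + esize (l x) * 4) (by fun_prop) fun x l₁ hl₁ => ?_
  have hcarry := foldl_mulStep_fst_le (m := m x) (c := 1) (by omega) l₁ []
  have hdigits := esize_le_of_forall_mem (l := (l₁.foldl (mulStep (m x)) (1, [])).2)
    fun b _ => esize_bool_le b
  rw [length_foldl_mulStep_snd, List.length_nil] at hdigits
  have hlength := hl₁.length_le.trans (length_le_esize (l x))
  rw [← Prod.mk.eta (p := l₁.foldl (mulStep (m x)) (1, [])), esize_pair, esize_nat, esize_nat]
  omega

@[fun_prop]
theorem PolyTime.countBits {m r : α → ℕ} (hm : PolyTime m) (hr : PolyTime r) :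
    PolyTime fun x => countBits (m x) (r x) := by
  let w x := (m x + 2) * r x
  have hw : PolyTime w := by fun_prop
  have hbits : PolyTime fun x => bits (w x) (∑ i ∈ Finset.range (r x), m x ^ i) := by
    refine (hr.iterate_of_bound (s := fun x l => (l.foldl (mulStep (m x)) (1, [])).2.reverse)
      (i := fun x => bits (w x) 0) ?_ ?_ (b := fun x => 1 + esize (w x) * 4) (by fun_prop)
      fun x j _ => ?_).congr fun x => (iterate_mulStep_eq_bits _ _ _).symm
    · simp only [bits_zero]
      fun_prop
    · exact (PolyTime.snd.comp (.foldl_mulStep (hm.comp .fst) .snd)).reverse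
    · rw [iterate_mulStep_eq_bits, esize_nat]
      exact (esize_bits_le _ _).trans (by omega)
  exact hbits.numDigits.congr fun x => (numDigits_bits (geom_sum_lt_two_pow _ _)).symm

end

/-! ### The formulas -/

/-- The variables of the formulas, together with their meaning for an automaton whose states and
letters are numbers, and for a list of words. -/
inductive Var : Type
  /-- the letter `a` leads from the state `q` to the state `s` -/
  | step (q a s : ℕ)
  /-- the state `q` is not final; the negation of finality is used because then a list of values
  that is too short describes an automaton that accepts more words, not fewer -/
  | reject (q : ℕ)
  /-- the bit `j` of the number of words of length less than `i` that are accepted from the state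
  `q` and are empty or start with a letter less than `a` -/
  | sum (i q a j : ℕ)
  /-- the carry into the bit `j` in the addition that computes the number with the bits
  `sum (i + 1) q (a + 1)` -/
  | carry (i q a j : ℕ)
  /-- the first `j` letters of the word with index `i` lead to the state `q` -/
  | reach (i j q : ℕ)

/-- The number that stands for a variable in the queries of the solver. -/
def Var.code : Var → ℕ
  | .step q a q' => Nat.pair 0 (Nat.pair q (Nat.pair a q'))
  | .reject q => Nat.pair 1 q
  | .sum i q a j => Nat.pair 2 (Nat.pair i (Nat.pair q (Nat.pair a j)))
  | .carry i q a j => Nat.pair 3 (Nat.pair i (Nat.pair q (Nat.pair a j)))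
  | .reach i j q => Nat.pair 4 (Nat.pair i (Nat.pair j q))

theorem Var.code_injective : Function.Injective Var.code := fun x y h => by
  cases x <;> cases y <;> simp_all [Var.code, Nat.pair_eq_pair]

instance : Enc Var := ⟨fun x => enc x.code⟩

/-- A formula in conjunctive normal form; the literal `(b, x)` says that `x` has the value `b`. The
truth value comes first because it does so in `encCnf`. -/
abbrev Formula : Type := List (List (Bool × Var))

/-- The formula as a query of the solver. -/
def Formula.toCnf (φ : Formula) : Cnf := φ.map (List.map fun l => (l.2.code, l.1))

theorem Formula.encCnf_toCnf (φ : Formula) : encCnf φ.toCnf = enc φ := by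
  rw [encCnf, Formula.toCnf, encList_map]
  simp only [encList_map]
  rfl

/-- The correct columns of a binary addition: the digits `x` and `y` and the carry `c` add up to the
digit `z` and the carry `d`. -/
def FullAdder (x y c z d : Bool) : Prop := z = (x ^^ (y ^^ c)) ∧ d = Bool.atLeastTwo x y c

instance (x y c z d : Bool) : Decidable (FullAdder x y c z d) := inferInstanceAs (Decidable (_ ∧ _))

/-- The incorrect columns of a binary addition. -/
def badColumns : List (Bool × Bool × Bool × Bool × Bool) :=
  ([false, true] ×ˢ [false, true] ×ˢ [false, true] ×ˢ [false, true] ×ˢ [false, true]).filter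
    fun t => !decide (FullAdder t.1 t.2.1 t.2.2.1 t.2.2.2.1 t.2.2.2.2)

theorem mem_badColumns : ∀ x y c z d, (x, y, c, z, d) ∈ badColumns ↔ ¬ FullAdder x y c z d := by
  decide

/-- Every letter leads from every state to some state. -/
def stepClauses (m n : ℕ) : Formula :=
  (List.range n).flatMap fun q => (List.range m).map fun a =>
    (List.range n).map fun s => (true, .step q a s)

/-- The word `w`, which has the index `i`, is accepted from the state `0`. -/
def wordClauses (n i : ℕ) (w : List ℕ) : Formula :=
  [(true, .reach i 0 0)] ::
    (((List.range w.length).flatMap fun j => (List.range n).flatMap fun q =>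
        (List.range n).map fun q' =>
          [(false, .reach i j q), (false, .step q (w.getD j 0) q'), (true, .reach i (j + 1) q')]) ++
      (List.range n).map fun q => [(false, .reach i w.length q), (false, .reject q)])

/-- There is no word of length less than `0`. -/
def zeroClauses (m n b : ℕ) : Formula :=
  (List.range n).flatMap fun q => (List.range b).map fun j => [(false, .sum 0 q m j)]

/-- The summation over the letters starts with the contribution of the empty word. -/
def emptyWordClauses (n r b : ℕ) : Formula :=
  (List.range r).flatMap fun i => (List.range n).flatMap fun q =>
    [(true, .sum (i + 1) q 0 0), (true, .reject q)] ::
      [(false, .sum (i + 1) q 0 0), (false, .reject q)] ::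
        (List.range b).map fun j => [(false, .sum (i + 1) q 0 (j + 1))]

/-- The additions start without a carry. -/
def carryClauses (m n r : ℕ) : Formula :=
  (List.range r).flatMap fun i => (List.range n).flatMap fun q =>
    (List.range m).map fun a => [(false, .carry i q a 0)]

/-- The summand of the letter `a` is the number of accepted words of length less than `i` from the
state to which `a` leads. -/
def adderClauses (m n r b : ℕ) : Formula :=
  (List.range r).flatMap fun i => (List.range n).flatMap fun q => (List.range m).flatMap fun a =>
    (List.range n).flatMap fun q' => (List.range b).flatMap fun j => badColumns.map fun t =>
      [(false, .step q a q'), (!t.1, .sum (i + 1) q a j), (!t.2.1, .sum i q' m j),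
        (!t.2.2.1, .carry i q a j), (!t.2.2.2.1, .sum (i + 1) q (a + 1) j),
        (!t.2.2.2.2, .carry i q a (j + 1))]

/-- The bits `k, k + 1, …` of the number of accepted words of length less than `r` are the elements
of `p`. -/
def bitClauses (m r k : ℕ) (p : List Bool) : Formula :=
  (List.range p.length).map fun i => [(p.getD i false, .sum r 0 m (k + i))]

/-- The formula saying that there is an automaton with `n` states which accepts the words of `l`
such that the bits `k, k + 1, …` of the number of accepted words of length less than `r` are the
elements of `p`. The numbers are represented by their last `b` bits. -/
def formula (m n r b : ℕ) (l : List (List ℕ)) (k : ℕ) (p : List Bool) : Formula :=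
  stepClauses m n ++ ((List.range l.length).flatMap (fun i => wordClauses n i (l.getD i [])) ++
    (zeroClauses m n b ++ (emptyWordClauses n r b ++ (carryClauses m n r ++
      (adderClauses m n r b ++ bitClauses m r k p)))))

section
variable {α : Type} [Enc α] {f g h i j k : α → ℕ}

@[fun_prop]
theorem PolyTime.varCode : PolyTime Var.code := .of_enc_eq fun _ => rfl

@[fun_prop]
theorem PolyTime.varStep (hf : PolyTime f) (hg : PolyTime g) (hh : PolyTime h) :
    PolyTime fun x => Var.step (f x) (g x) (h x) :=
  .of_enc_eq_enc (g := fun x => Nat.pair 0 (Nat.pair (f x) (Nat.pair (g x) (h x)))) (by fun_prop)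
    fun _ => rfl

@[fun_prop]
theorem PolyTime.varReject (hf : PolyTime f) : PolyTime fun x => Var.reject (f x) :=
  .of_enc_eq_enc (g := fun x => Nat.pair 1 (f x)) (by fun_prop) fun _ => rfl

@[fun_prop]
theorem PolyTime.varSum (hf : PolyTime f) (hg : PolyTime g) (hh : PolyTime h) (hi : PolyTime i) :
    PolyTime fun x => Var.sum (f x) (g x) (h x) (i x) :=
  .of_enc_eq_enc
    (g := fun x => Nat.pair 2 (Nat.pair (f x) (Nat.pair (g x) (Nat.pair (h x) (i x)))))
    (by fun_prop) fun _ => rfl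

@[fun_prop]
theorem PolyTime.varCarry (hf : PolyTime f) (hg : PolyTime g) (hh : PolyTime h) (hi : PolyTime i) :
    PolyTime fun x => Var.carry (f x) (g x) (h x) (i x) :=
  .of_enc_eq_enc
    (g := fun x => Nat.pair 3 (Nat.pair (f x) (Nat.pair (g x) (Nat.pair (h x) (i x)))))
    (by fun_prop) fun _ => rfl

@[fun_prop]
theorem PolyTime.varReach (hf : PolyTime f) (hg : PolyTime g) (hh : PolyTime h) :
    PolyTime fun x => Var.reach (f x) (g x) (h x) :=
  .of_enc_eq_enc (g := fun x => Nat.pair 4 (Nat.pair (f x) (Nat.pair (g x) (h x)))) (by fun_prop)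
    fun _ => rfl

@[fun_prop]
theorem PolyTime.stepClauses (hf : PolyTime f) (hg : PolyTime g) :
    PolyTime fun x => stepClauses (f x) (g x) := by
  unfold DFALearning.stepClauses; fun_prop

@[fun_prop]
theorem PolyTime.wordClauses {w : α → List ℕ} (hf : PolyTime f) (hg : PolyTime g)
    (hw : PolyTime w) : PolyTime fun x => wordClauses (f x) (g x) (w x) := by
  unfold DFALearning.wordClauses; fun_prop

@[fun_prop]
theorem PolyTime.zeroClauses (hf : PolyTime f) (hg : PolyTime g) (hh : PolyTime h) :
    PolyTime fun x => zeroClauses (f x) (g x) (h x) := by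
  unfold DFALearning.zeroClauses; fun_prop

@[fun_prop]
theorem PolyTime.emptyWordClauses (hf : PolyTime f) (hg : PolyTime g) (hh : PolyTime h) :
    PolyTime fun x => emptyWordClauses (f x) (g x) (h x) := by
  unfold DFALearning.emptyWordClauses; fun_prop

@[fun_prop]
theorem PolyTime.carryClauses (hf : PolyTime f) (hg : PolyTime g) (hh : PolyTime h) :
    PolyTime fun x => carryClauses (f x) (g x) (h x) := by
  unfold DFALearning.carryClauses; fun_prop

@[fun_prop]
theorem PolyTime.adderClauses (hf : PolyTime f) (hg : PolyTime g) (hh : PolyTime h)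
    (hi : PolyTime i) : PolyTime fun x => adderClauses (f x) (g x) (h x) (i x) := by
  unfold DFALearning.adderClauses; fun_prop

@[fun_prop]
theorem PolyTime.bitClauses {p : α → List Bool} (hf : PolyTime f) (hg : PolyTime g)
    (hh : PolyTime h) (hp : PolyTime p) :
    PolyTime fun x => bitClauses (f x) (g x) (h x) (p x) := by
  unfold DFALearning.bitClauses; fun_prop

@[fun_prop]
theorem PolyTime.formula {l : α → List (List ℕ)} {p : α → List Bool} (hf : PolyTime f)
    (hg : PolyTime g) (hh : PolyTime h) (hi : PolyTime i) (hl : PolyTime l) (hj : PolyTime j)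
    (hp : PolyTime p) :
    PolyTime fun x => formula (f x) (g x) (h x) (i x) (l x) (j x) (p x) := by
  unfold DFALearning.formula; fun_prop

end

/-! ### Binary addition -/

/-- The carry into the digit `j` of the sum of `x` and `y`. -/
def carry (x y j : ℕ) : Bool := decide (2 ^ j ≤ x % 2 ^ j + y % 2 ^ j)

theorem carry_zero (x y : ℕ) : carry x y 0 = false := by simp [carry, Nat.mod_one]

theorem fullAdder_carry (x y j : ℕ) : FullAdder (x.testBit j) (y.testBit j) (carry x y j)
    ((x + y).testBit j) (carry x y (j + 1)) := by
  have hmod (z : ℕ) : z % 2 ^ (j + 1) % 2 ^ j = z % 2 ^ j :=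
    Nat.mod_mod_of_dvd z (pow_dvd_pow 2 j.le_succ)
  have hbit (z : ℕ) : (BitVec.ofNat (j + 1) z).getLsbD j = z.testBit j := by
    rw [BitVec.getLsbD_ofNat, decide_eq_true j.lt_succ_self, Bool.true_and]
  have hcarry : BitVec.carry j (BitVec.ofNat (j + 1) x) (BitVec.ofNat (j + 1) y) false =
      carry x y j := by simp [BitVec.carry, carry, hmod]
  have hcarry' : BitVec.carry (j + 1) (BitVec.ofNat (j + 1) x) (BitVec.ofNat (j + 1) y) false =
      carry x y (j + 1) := by simp [BitVec.carry, carry]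
  have hsum := BitVec.getLsbD_add j.lt_succ_self (.ofNat (j + 1) x) (.ofNat (j + 1) y)
  rw [← BitVec.ofNat_add, hbit, hbit, hbit, hcarry] at hsum
  have hnext := BitVec.carry_succ j (.ofNat (j + 1) x) (.ofNat (j + 1) y) false
  rw [hbit, hbit, hcarry, hcarry'] at hnext
  exact ⟨hsum, hnext⟩

theorem testBit_add_of_fullAdder {x y b : ℕ} {c z : ℕ → Bool} (hc : c 0 = false)
    (h : ∀ j < b, FullAdder (x.testBit j) (y.testBit j) (c j) (z j) (c (j + 1))) :
    ∀ j < b, z j = (x + y).testBit j := by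
  have hcarry : ∀ j ≤ b, c j = carry x y j := by
    intro j
    induction j with
    | zero => exact fun _ => hc.trans (carry_zero x y).symm
    | succ j ih =>
      intro hj
      rw [(h j hj).2, ih (by omega), (fullAdder_carry x y j).2]
  intro j hj
  rw [(h j hj).1, hcarry j hj.le, (fullAdder_carry x y j).1]

/-! ### Automata on numbers -/

/-- `p` lists the bits of `x` from index `k` upwards. -/
def HasBits (x k : ℕ) (p : List Bool) : Prop := ∀ i < p.length, x.testBit (k + i) = p.getD i false

theorem hasBits_cons {x k : ℕ} {c : Bool} {p : List Bool} :
    HasBits x k (c :: p) ↔ x.testBit k = c ∧ HasBits x (k + 1) p := by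
  simp only [HasBits, List.length_cons, Nat.forall_lt_succ_left, List.getD_cons_zero,
    List.getD_cons_succ, add_zero, Nat.add_assoc, Nat.add_comm 1]

theorem HasBits.div_two_pow_eq {x y k : ℕ} {p : List Bool} (hx : HasBits x k p)
    (hy : HasBits y k p) (hx' : x < 2 ^ (k + p.length)) (hy' : y < 2 ^ (k + p.length)) :
    x / 2 ^ k = y / 2 ^ k := by
  refine Nat.eq_of_testBit_eq fun i => ?_
  rw [Nat.testBit_div_two_pow, Nat.testBit_div_two_pow, add_comm i]
  rcases lt_or_ge i p.length with hi | hi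
  · rw [hx i hi, hy i hi]
  · have hle : 2 ^ (k + p.length) ≤ 2 ^ (k + i) := by gcongr; norm_num
    rw [Nat.testBit_lt_two_pow (hx'.trans_le hle), Nat.testBit_lt_two_pow (hy'.trans_le hle)]

theorem div_two_pow_eq_add_testBit (x k : ℕ) :
    x / 2 ^ k = 2 * (x / 2 ^ (k + 1)) + (x.testBit k).toNat := by
  rw [Nat.toNat_testBit, pow_succ, ← Nat.div_div_eq_div_mul]
  omega

/-- An automaton whose states and letters are numbers, with the initial state `0`. -/
structure NatDFA where
  step : ℕ → ℕ → ℕ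
  final : ℕ → Bool

namespace NatDFA

/-- The number of words of length less than `i` over the letters `0, …, m - 1` that are accepted
from the state `q`. -/
def countFrom (A : NatDFA) (m : ℕ) : ℕ → ℕ → ℕ
  | 0, _ => 0
  | i + 1, q => (A.final q).toNat + ∑ a ∈ Finset.range m, A.countFrom m i (A.step q a)

/-- The part of `countFrom` given by the empty word and the words that start with a letter less
than `a`. -/
def countUpTo (A : NatDFA) (m : ℕ) : ℕ → ℕ → ℕ → ℕ
  | 0, _, _ => 0
  | i + 1, q, a => (A.final q).toNat + ∑ c ∈ Finset.range a, A.countFrom m i (A.step q c)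

/-- The automaton has a transition between the states `0, …, n - 1` for every letter less than `m`,
and it accepts the words of `l`. -/
structure Consistent (A : NatDFA) (m n : ℕ) (l : List (List ℕ)) : Prop where
  step_lt : ∀ q < n, ∀ a < m, A.step q a < n
  accepts : ∀ w ∈ l, A.final (w.foldl A.step 0) = true

variable {A : NatDFA} {m n : ℕ}

theorem countUpTo_self (i q : ℕ) : A.countUpTo m i q m = A.countFrom m i q := by
  cases i <;> rfl

theorem countUpTo_succ (i q a : ℕ) : A.countUpTo m (i + 1) q (a + 1) =
    A.countUpTo m (i + 1) q a + A.countFrom m i (A.step q a) := by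
  simp only [countUpTo, Finset.sum_range_succ, add_assoc]

theorem countFrom_le_geom_sum (i q : ℕ) : A.countFrom m i q ≤ ∑ k ∈ Finset.range i, m ^ k := by
  induction i generalizing q with
  | zero => simp [countFrom]
  | succ i ih =>
    rw [countFrom, geom_sum_succ, add_comm]
    gcongr
    · calc
        ∑ a ∈ Finset.range m, A.countFrom m i (A.step q a)
          ≤ ∑ _a ∈ Finset.range m, ∑ k ∈ Finset.range i, m ^ k := Finset.sum_le_sum fun _ _ => ih _
        _ = m * ∑ k ∈ Finset.range i, m ^ k := by simp
    · exact Bool.toNat_le _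

theorem foldl_step_lt (h : ∀ q < n, ∀ a < m, A.step q a < n) {w : List ℕ} (hw : ∀ a ∈ w, a < m)
    {q : ℕ} (hq : q < n) : w.foldl A.step q < n :=
  List.foldlRecOn (motive := (· < n)) w A.step hq fun q hq a ha => h q hq a (hw a ha)

theorem foldl_step_take_succ {w : List ℕ} {j : ℕ} (hj : j < w.length) :
    (w.take (j + 1)).foldl A.step 0 = A.step ((w.take j).foldl A.step 0) (w.getD j 0) := by
  rw [List.take_succ_eq_append_getElem hj, List.foldl_append, List.foldl_cons, List.foldl_nil,
    ← List.getD_eq_getElem _ 0 hj]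

end NatDFA

/-! ### The meaning of the formulas -/

/-- The valuation `v` satisfies the formula `φ`. -/
def Satisfies (v : Var → Bool) (φ : Formula) : Prop := ∀ C ∈ φ, ∃ l ∈ C, v l.2 = l.1

theorem sat_toCnf {w : ℕ → Bool} {φ : Formula} :
    Cnf.Sat w φ.toCnf ↔ Satisfies (w ∘ Var.code) φ := by
  rw [Cnf.Sat, Formula.toCnf, List.forall_mem_map]
  simp only [Satisfies, List.mem_map, exists_exists_and_eq_and, Function.comp_apply]

section
variable {v : Var → Bool}

theorem satisfies_append {φ ψ : Formula} :
    Satisfies v (φ ++ ψ) ↔ Satisfies v φ ∧ Satisfies v ψ := by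
  simp only [Satisfies, List.mem_append, or_imp, forall_and]

theorem satisfies_cons {C : List (Bool × Var)} {φ : Formula} :
    Satisfies v (C :: φ) ↔ (∃ l ∈ C, v l.2 = l.1) ∧ Satisfies v φ := by
  simp [Satisfies]

theorem satisfies_flatMap_range {k : ℕ} {φ : ℕ → Formula} :
    Satisfies v ((List.range k).flatMap φ) ↔ ∀ i < k, Satisfies v (φ i) := by
  simp only [Satisfies, List.mem_flatMap, List.mem_range]
  exact ⟨fun h i hi C hC => h C ⟨i, hi, hC⟩, fun h C ⟨i, hi, hC⟩ => h i hi C hC⟩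

theorem satisfies_map {β : Type} {l : List β} {C : β → List (Bool × Var)} :
    Satisfies v (l.map C) ↔ ∀ i ∈ l, ∃ l ∈ C i, v l.2 = l.1 := by
  simp [Satisfies]

theorem satisfies_stepClauses {m n : ℕ} : Satisfies v (stepClauses m n) ↔
    ∀ q < n, ∀ a < m, ∃ q' < n, v (.step q a q') = true := by
  simp [stepClauses, satisfies_flatMap_range, satisfies_map]

theorem satisfies_wordClauses {n i : ℕ} {w : List ℕ} : Satisfies v (wordClauses n i w) ↔
    v (.reach i 0 0) = true ∧
      (∀ j < w.length, ∀ q < n, ∀ q' < n, v (.reach i j q) = true →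
        v (.step q (w.getD j 0) q') = true → v (.reach i (j + 1) q') = true) ∧
      ∀ q < n, v (.reach i w.length q) = true → v (.reject q) = false := by
  simp [wordClauses, satisfies_flatMap_range, satisfies_map, satisfies_cons, satisfies_append,
    ← Bool.not_eq_true, ← imp_iff_not_or]

theorem satisfies_zeroClauses {m n b : ℕ} : Satisfies v (zeroClauses m n b) ↔
    ∀ q < n, ∀ j < b, v (.sum 0 q m j) = false := by
  simp [zeroClauses, satisfies_flatMap_range, satisfies_map]

theorem satisfies_emptyWordClauses {n r b : ℕ} : Satisfies v (emptyWordClauses n r b) ↔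
    ∀ i < r, ∀ q < n, v (.sum (i + 1) q 0 0) = !v (.reject q) ∧
      ∀ j < b, v (.sum (i + 1) q 0 (j + 1)) = false := by
  simp only [emptyWordClauses, satisfies_flatMap_range, satisfies_map, satisfies_cons]
  refine forall₄_congr fun i _ q _ => ?_
  cases hs : v (.sum (i + 1) q 0 0) <;> cases hr : v (.reject q) <;> simp [hs, hr]

theorem satisfies_carryClauses {m n r : ℕ} : Satisfies v (carryClauses m n r) ↔
    ∀ i < r, ∀ q < n, ∀ a < m, v (.carry i q a 0) = false := by
  simp [carryClauses, satisfies_flatMap_range, satisfies_map]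

theorem satisfies_adderClauses {m n r b : ℕ} : Satisfies v (adderClauses m n r b) ↔
    ∀ i < r, ∀ q < n, ∀ a < m, ∀ q' < n, ∀ j < b, v (.step q a q') = true →
      FullAdder (v (.sum (i + 1) q a j)) (v (.sum i q' m j)) (v (.carry i q a j))
        (v (.sum (i + 1) q (a + 1) j)) (v (.carry i q a (j + 1))) := by
  simp only [adderClauses, satisfies_flatMap_range, satisfies_map]
  refine forall₄_congr fun i _ q _ => forall₄_congr fun a _ q' _ => forall₂_congr fun j _ => ?_
  simp only [List.mem_cons, List.not_mem_nil, or_false, exists_eq_or_imp, exists_eq_left,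
    Prod.forall, mem_badColumns]
  constructor
  · intro h hs
    by_contra hbad
    simpa [hs] using h _ _ _ _ _ hbad
  · intro h x y c z d hbad
    by_contra! hne
    simp only [ne_eq, Bool.not_eq_not, Bool.not_eq_false] at hne
    obtain ⟨hs, rfl, rfl, rfl, rfl, rfl⟩ := hne
    exact hbad (h hs)

theorem satisfies_bitClauses {m r k : ℕ} {p : List Bool} : Satisfies v (bitClauses m r k p) ↔
    ∀ i < p.length, v (.sum r 0 m (k + i)) = p.getD i false := by
  simp [bitClauses, satisfies_map]

theorem satisfies_formula {m n r b k : ℕ} {l : List (List ℕ)} {p : List Bool} :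
    Satisfies v (formula m n r b l k p) ↔ Satisfies v (stepClauses m n) ∧
      (∀ i < l.length, Satisfies v (wordClauses n i (l.getD i []))) ∧
      Satisfies v (zeroClauses m n b) ∧ Satisfies v (emptyWordClauses n r b) ∧
      Satisfies v (carryClauses m n r) ∧ Satisfies v (adderClauses m n r b) ∧
      Satisfies v (bitClauses m r k p) := by
  simp only [formula, satisfies_append, satisfies_flatMap_range]

end

/-- The target of the transition from `q` with `a` that is described by the valuation `v`; if there
are several, it is the least one. -/
def readStep (n : ℕ) (v : Var → Bool) (q a : ℕ) : ℕ :=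
  ((List.range n).filter fun q' => v (.step q a q')).headD 0

theorem readStep_spec {n : ℕ} {v : Var → Bool} {q a : ℕ} (h : ∃ q' < n, v (.step q a q') = true) :
    readStep n v q a < n ∧ v (.step q a (readStep n v q a)) = true := by
  obtain ⟨q', hq', hv⟩ := h
  have hne : (List.range n).filter (fun q' => v (.step q a q')) ≠ [] :=
    List.ne_nil_of_mem (List.mem_filter.2 ⟨List.mem_range.2 hq', hv⟩)
  rw [readStep, List.headD_eq_head?_getD, List.head?_eq_some_head hne, Option.getD_some,
    ← List.mem_range]
  exact List.mem_filter.1 (List.head_mem hne)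

/-- The automaton described by the valuation `v`. -/
def NatDFA.ofValuation (n : ℕ) (v : Var → Bool) : NatDFA where
  step := readStep n v
  final q := !v (.reject q)

section
variable {v : Var → Bool} {m n r b : ℕ}

theorem final_foldl_of_satisfies {i : ℕ} {w : List ℕ} (hn : 1 ≤ n) (hw : ∀ a ∈ w, a < m)
    (hstep : Satisfies v (stepClauses m n)) (hword : Satisfies v (wordClauses n i w)) :
    (NatDFA.ofValuation n v).final (w.foldl (NatDFA.ofValuation n v).step 0) = true := by
  set A := NatDFA.ofValuation n v
  rw [satisfies_stepClauses] at hstep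
  obtain ⟨hstart, hnext, hend⟩ := satisfies_wordClauses.1 hword
  have hlt : ∀ q < n, ∀ a < m, A.step q a < n :=
    fun q hq a ha => (readStep_spec (hstep q hq a ha)).1
  have hreach : ∀ j ≤ w.length, v (.reach i j ((w.take j).foldl A.step 0)) = true := by
    intro j
    induction j with
    | zero => exact fun _ => hstart
    | succ j ih =>
      intro hj
      have hq : (w.take j).foldl A.step 0 < n :=
        NatDFA.foldl_step_lt hlt (fun a ha => hw a (List.mem_of_mem_take ha)) hn
      have ha : w.getD j 0 < m := by
        rw [List.getD_eq_getElem _ _ hj]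
        exact hw _ (List.getElem_mem _)
      obtain ⟨hq', hv⟩ := readStep_spec (hstep _ hq _ ha)
      rw [NatDFA.foldl_step_take_succ hj]
      exact hnext j hj _ hq _ hq' (ih (by omega)) hv
  have hfinal := hreach _ le_rfl
  rw [List.take_length] at hfinal
  have hreject := hend _ (NatDFA.foldl_step_lt hlt hw hn) hfinal
  exact Bool.not_eq_eq_eq_not.2 hreject

theorem testBit_countFrom_of_satisfies (hstep : Satisfies v (stepClauses m n))
    (hzero : Satisfies v (zeroClauses m n b)) (hempty : Satisfies v (emptyWordClauses n r b))
    (hcarry : Satisfies v (carryClauses m n r)) (hadder : Satisfies v (adderClauses m n r b)) :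
    ∀ i ≤ r, ∀ q < n, ∀ j < b,
      v (.sum i q m j) = ((NatDFA.ofValuation n v).countFrom m i q).testBit j := by
  rw [satisfies_stepClauses] at hstep
  rw [satisfies_zeroClauses] at hzero
  rw [satisfies_emptyWordClauses] at hempty
  rw [satisfies_carryClauses] at hcarry
  rw [satisfies_adderClauses] at hadder
  intro i
  induction i with
  | zero =>
    intro _ q hq j hj
    rw [hzero q hq j hj, NatDFA.countFrom, Nat.zero_testBit]
  | succ i ih =>
    intro hi q hq
    suffices hpartial : ∀ a ≤ m, ∀ j < b,
        v (.sum (i + 1) q a j) = ((NatDFA.ofValuation n v).countUpTo m (i + 1) q a).testBit j by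
      simpa only [NatDFA.countUpTo_self] using hpartial m le_rfl
    intro a
    induction a with
    | zero =>
      intro _ j hj
      obtain ⟨hfirst, hrest⟩ := hempty i hi q hq
      cases j with
      | zero => cases hr : v (.reject q) <;> simp [NatDFA.countUpTo, NatDFA.ofValuation, hfirst, hr]
      | succ j =>
        cases hr : v (.reject q) <;>
          simp [NatDFA.countUpTo, NatDFA.ofValuation, hrest j (by omega), hr, Nat.testBit_succ]
    | succ a iha =>
      intro ha
      obtain ⟨hq', hv⟩ := readStep_spec (hstep q hq a ha)
      rw [NatDFA.countUpTo_succ]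
      refine testBit_add_of_fullAdder (c := fun j => v (.carry i q a j)) (hcarry i hi q hq a ha)
        fun j hj => ?_
      rw [← iha (by omega) j hj]
      exact ih (by omega) _ hq' j hj ▸ hadder i hi q hq a ha _ hq' j hj hv

theorem formula_sound {k : ℕ} {l : List (List ℕ)} {p : List Bool} (hn : 1 ≤ n)
    (hl : ∀ w ∈ l, ∀ a ∈ w, a < m) (hk : k + p.length ≤ b)
    (h : Satisfies v (formula m n r b l k p)) :
    (NatDFA.ofValuation n v).Consistent m n l ∧
      HasBits ((NatDFA.ofValuation n v).countFrom m r 0) k p := by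
  obtain ⟨hstep, hword, hzero, hempty, hcarry, hadder, hbit⟩ := satisfies_formula.1 h
  refine ⟨⟨fun q hq a ha => (readStep_spec (satisfies_stepClauses.1 hstep q hq a ha)).1,
    fun w hw => ?_⟩, fun i hi => ?_⟩
  · obtain ⟨i, hi, rfl⟩ := List.mem_iff_getElem.1 hw
    exact final_foldl_of_satisfies hn (hl _ hw) hstep (List.getD_eq_getElem l [] hi ▸ hword i hi)
  · rw [← testBit_countFrom_of_satisfies hstep hzero hempty hcarry hadder r le_rfl 0 hn _
      (by omega)]
    exact satisfies_bitClauses.1 hbit i hi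

end

/-- The valuation that describes the automaton `A` and its runs on the words of `l`. -/
def NatDFA.describe (A : NatDFA) (m : ℕ) (l : List (List ℕ)) : Var → Bool
  | .step q a q' => decide (A.step q a = q')
  | .reject q => !A.final q
  | .sum i q a j => (A.countUpTo m i q a).testBit j
  | .carry i q a j => carry (A.countUpTo m (i + 1) q a) (A.countFrom m i (A.step q a)) j
  | .reach i j q => decide (((l.getD i []).take j).foldl A.step 0 = q)

theorem formula_complete {A : NatDFA} {m n r b k : ℕ} {l : List (List ℕ)} {p : List Bool}
    (h : A.Consistent m n l) (hp : HasBits (A.countFrom m r 0) k p) :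
    Satisfies (A.describe m l) (formula m n r b l k p) := by
  simp only [satisfies_formula, satisfies_stepClauses, satisfies_wordClauses,
    satisfies_zeroClauses, satisfies_emptyWordClauses, satisfies_carryClauses,
    satisfies_adderClauses, satisfies_bitClauses, NatDFA.describe, decide_eq_true_eq]
  refine ⟨fun q hq a ha => ⟨_, h.step_lt q hq a ha, rfl⟩, fun i hi => ⟨rfl, ?_, ?_⟩, ?_, ?_, ?_,
    ?_, ?_⟩
  · rintro j hj q - q' - rfl rfl
    exact NatDFA.foldl_step_take_succ hj
  · rintro q - rfl
    rw [List.take_length, List.getD_eq_getElem _ _ hi, h.accepts _ (List.getElem_mem hi)]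
    rfl
  · intro q _ j _
    rw [NatDFA.countUpTo, Nat.zero_testBit]
  · intro i _ q _
    cases hf : A.final q <;> simp [NatDFA.countUpTo, hf, Nat.testBit_succ]
  · intro i _ q _ a _
    exact carry_zero _ _
  · rintro i - q - a - _ - j - rfl
    rw [NatDFA.countUpTo_self, NatDFA.countUpTo_succ]
    exact fullAdder_carry _ _ _
  · intro i hi
    rw [NatDFA.countUpTo_self]
    exact hp i hi

theorem exists_sat_formula {A : NatDFA} {m n r b k : ℕ} {l : List (List ℕ)} {p : List Bool}
    (h : A.Consistent m n l) (hp : HasBits (A.countFrom m r 0) k p) :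
    ∃ w, Cnf.Sat w (formula m n r b l k p).toCnf := by
  refine ⟨Function.extend Var.code (A.describe m l) fun _ => false, sat_toCnf.2 ?_⟩
  rw [Function.extend_comp Var.code_injective]
  exact formula_complete h hp

/-! ### Automata on numbers and finite automata -/

theorem encList_finRange {β : Type} [Enc β] {k : ℕ} {F : Fin k → Data} {g : ℕ → β}
    (h : ∀ i : Fin k, F i = enc (g i)) :
    encList F (List.finRange k) = enc ((List.range k).map g) := by
  rw [encList_eq_enc_map h, ← List.map_coe_finRange_eq_range, List.map_map]
  rfl

namespace NatDFA

/-- The words over the alphabet `Fin m` that are accepted from the state `q`. -/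
def langFrom (A : NatDFA) (m q : ℕ) : Set (List (Fin m)) :=
  {w | A.final ((w.map Fin.val).foldl A.step q) = true}

/-- The restriction of the automaton to the states `0, …, n - 1` and the letters less than `m`. -/
def toDFA (A : NatDFA) {m n : ℕ} (hn : 0 < n) (hA : ∀ q < n, ∀ a < m, A.step q a < n) :
    DFA (Fin m) (Fin n) where
  step q a := ⟨A.step q a, hA q q.2 a a.2⟩
  start := ⟨0, hn⟩
  accept := {q | A.final q = true}

/-- The components of the automaton `A.toDFA`, as they are encoded by `encDFA`. -/
def table (A : NatDFA) (m n : ℕ) : ℕ × List (List ℕ) × List Bool :=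
  (0, (List.range n).map fun q => (List.range m).map fun a => A.step q a,
    (List.range n).map fun q => A.final q)

variable {A : NatDFA} {m n : ℕ}

theorem nil_mem_langFrom {q : ℕ} : [] ∈ A.langFrom m q ↔ A.final q = true := Iff.rfl

theorem cons_mem_langFrom {q : ℕ} {a : Fin m} {w : List (Fin m)} :
    a :: w ∈ A.langFrom m q ↔ w ∈ A.langFrom m (A.step q a) := Iff.rfl

theorem ncard_langFrom (A : NatDFA) (m i q : ℕ) :
    {w | w ∈ A.langFrom m q ∧ w.length < i}.ncard = A.countFrom m i q := by
  induction i generalizing q with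
  | zero => simp [countFrom]
  | succ i ih =>
    have hfinite (q) : {w | w ∈ A.langFrom m q ∧ w.length < i}.Finite :=
      (List.finite_length_lt (Fin m) i).subset fun w hw => hw.2
    have hsplit : {w | w ∈ A.langFrom m q ∧ w.length < i + 1} =
        {w | A.final q = true ∧ w = []} ∪
          ⋃ a : Fin m, List.cons a '' {w | w ∈ A.langFrom m (A.step q a) ∧ w.length < i} := by
      ext w
      cases w <;> simp [nil_mem_langFrom, cons_mem_langFrom]
    have hdisjoint : Pairwise fun a b : Fin m => Disjoint
        (List.cons a '' {w | w ∈ A.langFrom m (A.step q a) ∧ w.length < i})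
        (List.cons b '' {w | w ∈ A.langFrom m (A.step q b) ∧ w.length < i}) := by
      intro a b hab
      rw [Set.disjoint_left]
      rintro _ ⟨w, -, rfl⟩ ⟨w', -, h⟩
      exact hab (List.cons.inj h).1.symm
    rw [hsplit, Set.ncard_union_eq ?_ ((Set.finite_singleton []).subset fun w hw => hw.2)
      (Set.finite_iUnion fun a => (hfinite _).image _), Set.ncard_iUnion_of_finite
      (fun a => (hfinite _).image _) hdisjoint, finsum_eq_sum_of_fintype, countFrom,
      ← Fin.sum_univ_eq_sum_range (fun a => A.countFrom m i (A.step q a))]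
    · congr 1
      · cases A.final q <;> simp
      · exact Finset.sum_congr rfl fun a _ => by
          rw [Set.ncard_image_of_injective _ List.cons_injective, ih]
    · rw [Set.disjoint_left]
      rintro _ ⟨-, rfl⟩ h
      simp at h

theorem count_eq_of_lang_eq {B : FinDFA (Fin m)} (h : B.lang = A.langFrom m 0) (k : ℕ) :
    B.count k = A.countFrom m (k + 1) 0 := by
  simp only [FinDFA.count, ← ncard_langFrom, h, Nat.lt_succ_iff]

theorem consistent_iff {l : List (List (Fin m))}
    (hA : ∀ q < n, ∀ a < m, A.step q a < n) :
    A.Consistent m n (l.map (List.map Fin.val)) ↔ {w | w ∈ l} ⊆ A.langFrom m 0 :=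
  ⟨fun h _ hw => h.accepts _ (List.mem_map_of_mem hw),
    fun h => ⟨hA, List.forall_mem_map.2 fun _ hw => h hw⟩⟩

theorem lang_toDFA (hn : 0 < n) (hA : ∀ q < n, ∀ a < m, A.step q a < n) :
    FinDFA.lang { State := Fin n, toDFA := A.toDFA hn hA } = A.langFrom m 0 := by
  have heval (w : List (Fin m)) (q : Fin n) :
      ((A.toDFA hn hA).evalFrom q w : ℕ) = (w.map Fin.val).foldl A.step q := by
    induction w generalizing q with
    | nil => rfl
    | cons a w ih => rw [DFA.evalFrom_cons, ih]; rfl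
  ext w
  change A.final ((A.toDFA hn hA).eval w) = true ↔ _
  rw [DFA.eval, heval]
  rfl

theorem encDFA_toDFA (hn : 0 < n) (hA : ∀ q < n, ∀ a < m, A.step q a < n) :
    encDFA (A.toDFA hn hA) = enc (A.table m n) := by
  classical
  have hfinal (q : Fin n) : decide (q ∈ (A.toDFA hn hA).accept) = A.final q := by
    rw [Bool.eq_iff_iff, decide_eq_true_eq]
    rfl
  exact congrArg₂ Data.cons rfl (congrArg₂ Data.cons
    (encList_finRange fun q => encList_finRange fun a => rfl)
    (encList_finRange fun q => congrArg encBool (hfinal q)))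

end NatDFA

theorem exists_injective_nat_of_card_le {σ : Type} [Fintype σ] {n : ℕ} (h : Fintype.card σ ≤ n)
    (s : σ) : ∃ e : σ → ℕ, Function.Injective e ∧ (∀ x, e x < n) ∧ e s = 0 := by
  let g : σ ≃ Fin (Fintype.card σ) := Fintype.equivFin σ
  let z : Fin (Fintype.card σ) := ⟨0, Fintype.card_pos_iff.2 ⟨s⟩⟩
  exact ⟨fun x => Equiv.swap (g s) z (g x),
    Fin.val_injective.comp ((Equiv.injective _).comp g.injective),
    fun x => (Fin.is_lt _).trans_le h, by simp [z]⟩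

theorem FinDFA.exists_natDFA {m n : ℕ} (B : FinDFA (Fin m)) (hB : B.size ≤ n) :
    ∃ A : NatDFA, (∀ q < n, ∀ a < m, A.step q a < n) ∧ B.lang = A.langFrom m 0 := by
  classical
  obtain ⟨e, he, hlt, hstart⟩ := exists_injective_nat_of_card_le hB B.toDFA.start
  have : Nonempty B.State := ⟨B.toDFA.start⟩
  let A : NatDFA :=
    { step q a := if h : a < m then e (B.toDFA.step (Function.invFun e q) ⟨a, h⟩) else 0
      final q := decide (Function.invFun e q ∈ B.toDFA.accept) }
  refine ⟨A, fun q _ a ha => ?_, ?_⟩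
  · simp only [A, ha, dif_pos, hlt]
  · have hfoldl (w : List (Fin m)) (s : B.State) :
        (w.map Fin.val).foldl A.step (e s) = e (B.toDFA.evalFrom s w) := by
      induction w generalizing s with
      | nil => rfl
      | cons a w ih =>
        rw [List.map_cons, List.foldl_cons, DFA.evalFrom_cons, ← ih]
        simp [A, Function.leftInverse_invFun he s]
    ext w
    rw [NatDFA.langFrom, Set.mem_ofPred_eq, ← hstart, hfoldl, decide_eq_true_eq,
      Function.leftInverse_invFun he]
    rfl

/-! ### The size of the input -/

theorem encInput_eq {m : ℕ} (n : ℕ) (l : List (List (Fin m))) :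
    encInput m n l = enc (m, n, l.map (List.map Fin.val)) := by
  have hword (w : List (Fin m)) : encList (fun a : Fin m => encNat a) w = enc (w.map Fin.val) :=
    encList_eq_enc_map (f := Fin.val) (fun _ => rfl) w
  rw [encInput, encList_eq_enc_map hword]
  rfl

section
variable {α : Type} {l : List (List α)}

theorem Pref_finite (l : List (List α)) : (Pref {w | w ∈ l}).Finite := by
  refine (List.finite_toSet (l.flatMap List.inits)).subset ?_
  rintro u ⟨w, hw, hu⟩
  exact List.mem_flatMap.2 ⟨w, hw, (List.mem_inits _ _).2 hu⟩

theorem length_le_ncard_Pref (hl : l.Nodup) : l.length ≤ (Pref {w | w ∈ l}).ncard := by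
  classical
  rw [← List.toFinset_card_of_nodup hl, ← Set.ncard_coe_finset]
  exact Set.ncard_le_ncard (fun w hw => ⟨w, List.mem_toFinset.1 hw, List.prefix_rfl⟩)
    (Pref_finite l)

theorem length_word_le_ncard_Pref {w : List α} (hw : w ∈ l) :
    w.length ≤ (Pref {w | w ∈ l}).ncard := by
  have hinj : Set.InjOn (fun i => w.take i) (Finset.range w.length : Set ℕ) := by
    intro i hi j hj hij
    have := congrArg List.length hij
    simp only [Finset.coe_range, Set.mem_Iio, List.length_take] at hi hj this
    omega
  calc
    w.length = (Finset.range w.length : Set ℕ).ncard := by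
      rw [Set.ncard_coe_finset, Finset.card_range]
    _ ≤ (Pref {w | w ∈ l}).ncard := Set.ncard_le_ncard_of_injOn _
      (fun i _ => ⟨w, hw, List.take_prefix i w⟩) hinj (Pref_finite l)

end

theorem esize_input_le {m : ℕ} (n : ℕ) {l : List (List (Fin m))} (hm : 1 ≤ m) (hl : l.Nodup) :
    esize (m, n, l.map (List.map Fin.val)) ≤ 13 * (m + (Pref {w | w ∈ l}).ncard + n) ^ 3 := by
  set N := m + (Pref {w | w ∈ l}).ncard + n with hN
  have hword : ∀ w ∈ l.map (List.map Fin.val), esize w ≤ 1 + N * (2 * N) := by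
    refine List.forall_mem_map.2 fun w hw => ?_
    have hletter : ∀ a ∈ w.map Fin.val, esize a ≤ 2 * m - 1 := by
      refine List.forall_mem_map.2 fun a _ => ?_
      rw [esize_nat]
      omega
    have hlength := length_word_le_ncard_Pref hw
    refine (esize_le_of_forall_mem hletter).trans ?_
    rw [List.length_map]
    gcongr <;> omega
  have hlist := esize_le_of_forall_mem hword
  have hlength := length_le_ncard_Pref hl
  rw [List.length_map] at hlist
  have hcubic : l.length * (1 + (1 + N * (2 * N))) ≤ N * (1 + (1 + N * (2 * N))) := by
    gcongr
    omega
  rw [esize_pair, esize_pair, esize_nat, esize_nat]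
  have : 1 ≤ N := by omega
  nlinarith [Nat.pow_le_pow_right this (show 1 ≤ 3 by norm_num), Nat.one_le_pow 3 N this]

/-! ### Answers of the solver -/

/-- The answer of the solver to the query `φ`, as the program sees it. -/
def answer (S : SatSolver) (φ : Formula) : Option (List Bool) :=
  (S.solve φ.toCnf).map fun v => (List.range φ.toCnf.numVars).map v

/-- The valuation that is given by a list of values; variables beyond its end are false. -/
def valuation (vals : List Bool) (x : Var) : Bool := vals.getD x.code false

theorem Run.ask_answer (S : SatSolver) (φ : Formula) :
    Run S .ask (enc φ) (enc (answer S φ)) (1 + esize φ + esize (answer S φ)) [φ.toCnf] := by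
  have henc : encAnswer φ.toCnf (S.solve φ.toCnf) = enc (answer S φ) := by
    rw [answer]
    cases S.solve φ.toCnf <;> rfl
  rw [esize, esize, ← henc, ← φ.encCnf_toCnf]
  exact .ask _

theorem Cnf.lt_numVars {φ : Cnf} {C : List (ℕ × Bool)} {l : ℕ × Bool} (hC : C ∈ φ) (hl : l ∈ C) :
    l.1 < φ.numVars :=
  List.le_max_of_le (α := ℕ) (List.mem_map.2 ⟨l, List.mem_flatten_of_mem hC hl, rfl⟩) le_rfl

theorem Cnf.Sat.congr {φ : Cnf} {v w : ℕ → Bool} (hv : φ.Sat v) (h : ∀ i < φ.numVars, v i = w i) :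
    φ.Sat w := fun C hC => by
  obtain ⟨l, hl, hvl⟩ := hv C hC
  exact ⟨l, hl, h l.1 (lt_numVars hC hl) ▸ hvl⟩

theorem Formula.numVars_toCnf_le (φ : Formula) : φ.toCnf.numVars ≤ esize φ := by
  refine List.max_le_of_forall_le _ _ fun i hi => ?_
  simp only [Formula.toCnf, List.mem_map, List.mem_flatten] at hi
  obtain ⟨_, ⟨_, ⟨C, hC, rfl⟩, hl'⟩, rfl⟩ := hi
  obtain ⟨l, hl, rfl⟩ := List.mem_map.1 hl'
  have hle : esize l ≤ esize φ := (esize_le_of_mem hl).trans (esize_le_of_mem hC)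
  have hcode : esize l.2 = 2 * l.2.code + 1 := esize_nat _
  have := esize_pair l.1 l.2
  change esize l = _ at this
  dsimp only
  omega

theorem length_le_of_answer_eq_some {S : SatSolver} {φ : Formula} {vals : List Bool}
    (h : answer S φ = some vals) : vals.length ≤ esize φ := by
  obtain ⟨v, -, rfl⟩ := Option.map_eq_some_iff.1 h
  simpa using φ.numVars_toCnf_le

theorem esize_bools_le (l : List Bool) : esize l ≤ 1 + 4 * l.length := by
  have := esize_le_of_forall_mem fun b (_ : b ∈ l) => esize_bool_le b
  omega

theorem esize_answer_le (S : SatSolver) (φ : Formula) :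
    esize (answer S φ) ≤ 3 + 4 * esize φ := by
  rcases h : answer S φ with _ | vals
  · exact (by decide : esize (none : Option (List Bool)) ≤ 3).trans (Nat.le_add_right _ _)
  · have := length_le_of_answer_eq_some h
    have := esize_bools_le vals
    have : esize (some vals) = 1 + 1 + esize vals := rfl
    omega

theorem satisfies_of_answer_eq_some {S : SatSolver} {φ : Formula} {vals : List Bool}
    (h : answer S φ = some vals) : Satisfies (valuation vals) φ := by
  obtain ⟨v, hv, rfl⟩ := Option.map_eq_some_iff.1 h
  have hsat : Cnf.Sat (fun i => ((List.range φ.toCnf.numVars).map v).getD i false) φ.toCnf :=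
    (S.sound _ _ hv).congr fun i hi => by simp [hi]
  exact sat_toCnf.1 hsat

theorem not_sat_of_answer_eq_none {S : SatSolver} {φ : Formula} (h : answer S φ = none)
    (w : ℕ → Bool) : ¬ Cnf.Sat w φ.toCnf :=
  S.complete _ (Option.map_eq_none_iff.1 h) w

/-! ### Loops with one query per round -/

section
variable {σ : Type} [Enc σ] {query : ℕ × σ → Formula} {update : Option (List Bool) × ℕ × σ → σ}

theorem exists_query_round (hq : PolyTime query) (hu : PolyTime update) :
    ∃ (p : Prog) (T : ℕ[X]), ∀ S k s, ∃ t,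
      Run S p (enc (k + 1, s)) (enc (k, update (answer S (query (k, s)), k, s))) t
        [(query (k, s)).toCnf] ∧
      t ≤ T.eval (esize (k, s)) ∧ esize (query (k, s)) ≤ T.eval (esize (k, s)) := by
  have hquery : PolyTime fun x : (Unit × ℕ) × σ => query (x.1.2, x.2) :=
    hq.comp (f := fun x : (Unit × ℕ) × σ => (x.1.2, x.2)) (by fun_prop)
  have hresult : PolyTime fun x : Option (List Bool) × (Unit × ℕ) × σ =>
      (x.2.1.2, update (x.1, x.2.1.2, x.2.2)) :=
    .prodMk (by fun_prop) (hu.comp (f := fun x : Option (List Bool) × (Unit × ℕ) × σ =>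
      (x.1, x.2.1.2, x.2.2)) (by fun_prop))
  obtain ⟨q, Q, hQ⟩ := hquery
  obtain ⟨u, U, hU⟩ := hresult
  have hbound : PolyBounded fun x : ℕ × σ =>
      6 * (1 + esize x + 2 + Q.eval (esize x + 2)) +
        U.eval (1 + (3 + 4 * Q.eval (esize x + 2)) + (esize x + 2)) := by fun_prop
  obtain ⟨T, hT⟩ := hbound
  refine ⟨.seq (.pair (.seq q .ask) .id) u, T, fun S k s => ?_⟩
  obtain ⟨tu, hrunu, htu⟩ := hU S (answer S (query (k, s)), ((), k), s)
  have hsize : esize (((), k), s) = esize (k, s) + 2 := by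
    simp only [esize_pair]
    have : esize () = 1 := rfl
    omega
  obtain ⟨tq, hrunq, htq⟩ := hQ S (((), k), s)
  rw [hsize] at htq
  have hle : esize (query (k, s)) ≤ Q.eval (esize (k, s) + 2) := hrunq.size_le.trans htq
  have hans := esize_answer_le S (query (k, s))
  rw [esize_pair, hsize] at htu
  have htu' : tu ≤ U.eval (1 + (3 + 4 * Q.eval (esize (k, s) + 2)) + (esize (k, s) + 2)) :=
    htu.trans (eval_mono U (by omega))
  have htime := hT (k, s)
  dsimp only at htime
  have hround := Run.seq (.pair (.seq hrunq (.ask_answer S _)) (.id _)) hrunu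
  refine ⟨_, hround, ?_, by omega⟩
  change 1 + esize (((), k), s) + (1 + esize (((), k), s) + (1 + esize (((), k), s) + tq +
    (1 + esize (query (k, s)) + esize (answer S (query (k, s))))) + (1 + esize (((), k), s))) +
    tu ≤ _
  omega

theorem exists_query_loop (hq : PolyTime query) (hu : PolyTime update) :
    ∃ (p : Prog) (T : ℕ[X]), ∀ (S : SatSolver) (I : ℕ → σ → Prop) (M : ℕ),
      (∀ k s, I k s → esize (k, s) ≤ M) →
      (∀ k s, I (k + 1) s → I k (update (answer S (query (k, s)), k, s))) →
      ∀ k s, I k s → ∃ s' t qs, Run S p (enc (k, s)) (enc (0, s')) t qs ∧ I 0 s' ∧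
        t ≤ (k + 1) * (1 + M + T.eval M) ∧ qs.length ≤ k ∧ ∀ φ ∈ qs, φ.size ≤ T.eval M := by
  obtain ⟨p, T, hround⟩ := exists_query_round hq hu
  refine ⟨.loop p, T, fun S I M hM hI k => ?_⟩
  induction k with
  | zero =>
    intro s hs
    refine ⟨s, _, _, .loopStop rfl, hs, ?_, by simp, by simp⟩
    have := hM 0 s hs
    simp only [esize] at *
    omega
  | succ k ih =>
    intro s hs
    obtain ⟨t, hrun, ht, hφ⟩ := hround S k s
    obtain ⟨s', u, qs, hloop, hs', hu, hlength, hqs⟩ := ih _ (hI k s hs)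
    have hle : esize (k, s) ≤ M := by
      have := hM _ s hs
      simp only [esize_pair, esize_nat] at *
      omega
    have hT := eval_mono T hle
    refine ⟨s', _, _, .loopStep (by simp [Data.hd]) hrun hloop, hs', ?_, by simpa using hlength,
      List.forall_mem_cons.2 ⟨?_, hqs⟩⟩
    · have := hM _ s hs
      rw [add_mul _ 1, one_mul]
      simp only [esize] at *
      omega
    · rw [Cnf.size, Formula.encCnf_toCnf]
      exact hφ.trans hT

end

/-! ### The search for the least number of accepted words -/

/-- An instance of the learning task over numbers: the letters are `0, …, letters - 1`, the
automata sought have the states `0, …, states - 1`, and they have to accept `words`. -/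
structure Task where
  letters : ℕ
  states : ℕ
  words : List (List ℕ)

namespace Task

instance : Enc Task := ⟨fun T => enc (T.letters, T.states, T.words)⟩

/-- The number of words of length at most `2 * T.states - 2` that `A` accepts. -/
def count (T : Task) (A : NatDFA) : ℕ := A.countFrom T.letters (2 * T.states - 1) 0

/-- A number of bits that suffices for the values of `T.count`. -/
def width (T : Task) : ℕ := countBits T.letters (2 * T.states - 1)

/-- The automata that satisfy the constraints of the task. -/
def Feasible (T : Task) (A : NatDFA) : Prop := A.Consistent T.letters T.states T.words

/-- Positivity of the number of states, and validity of the letters in the words. -/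
structure WellFormed (T : Task) : Prop where
  one_le_states : 1 ≤ T.states
  letter_lt : ∀ w ∈ T.words, ∀ a ∈ w, a < T.letters

/-- The formula saying that some feasible automaton has a count whose bits from index `k + 1`
upwards are `known`, and whose bit `k` is 0. -/
def query (T : Task) (k : ℕ) (known : List Bool) : Formula :=
  formula T.letters T.states (2 * T.states - 1) T.width T.words k (false :: known)

/-- The automaton described by a list of values of variables. -/
def automaton (T : Task) (vals : List Bool) : NatDFA := .ofValuation T.states (valuation vals)

variable {T : Task}

theorem count_lt (T : Task) (A : NatDFA) : T.count A < 2 ^ T.width :=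
  (A.countFrom_le_geom_sum _ _).trans_lt (Nat.lt_size_self _)

theorem feasible_automaton_nil (hT : T.WellFormed) : T.Feasible (T.automaton []) where
  step_lt q _ a _ := by
    simpa [automaton, NatDFA.ofValuation, readStep, valuation] using
      Nat.lt_of_lt_of_le Nat.one_pos hT.one_le_states
  accepts w _ := by simp [automaton, NatDFA.ofValuation, valuation]

theorem exists_isLeast_count (hT : T.WellFormed) :
    ∃ μ, IsLeast (T.count '' {A | T.Feasible A}) μ :=
  ⟨_, isLeast_csInf ⟨_, _, feasible_automaton_nil hT, rfl⟩⟩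

end Task

/-- The state of the search for the least count: its known bits, the most significant one last, and
the values of variables that describe the best automaton found so far. -/
structure SearchState where
  known : List Bool
  best : List Bool

instance : Enc SearchState := ⟨fun s => enc (s.known, s.best)⟩

/-- The new state after the answer of the solver to the query about the next bit. -/
def SearchState.update (s : SearchState) (a : Option (List Bool)) : SearchState where
  known := (!a.isSome) :: s.known
  best := a.getD s.best

/-- The bits of the least count `μ` from index `k` upwards are known, and the best automaton is
optimal up to the bits below index `k`. -/
structure SearchInv (T : Task) (μ k : ℕ) (s : SearchState) : Prop where
  length_known : k + s.known.length = T.width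
  feasible : T.Feasible (T.automaton s.best)
  hasBits : HasBits μ k s.known
  count_le : T.count (T.automaton s.best) / 2 ^ k ≤ μ / 2 ^ k

namespace SearchInv

variable {T : Task} {μ k : ℕ} {s : SearchState}

theorem initial (hT : T.WellFormed) (μ : ℕ) : SearchInv T μ T.width ⟨[], []⟩ where
  length_known := rfl
  feasible := T.feasible_automaton_nil hT
  hasBits i hi := absurd hi (Nat.not_lt_zero i)
  count_le := by simp [Nat.div_eq_of_lt (T.count_lt _)]

theorem of_satisfies {vals : List Bool} (hT : T.WellFormed)
    (hμ : IsLeast (T.count '' {A | T.Feasible A}) μ) (h : SearchInv T μ (k + 1) s)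
    (hvals : Satisfies (valuation vals) (T.query k s.known)) :
    SearchInv T μ k ⟨false :: s.known, vals⟩ := by
  have hlength : k + (false :: s.known).length = T.width := by
    rw [← h.length_known, List.length_cons]
    omega
  obtain ⟨hfeasible, hbits⟩ :=
    formula_sound hT.one_le_states hT.letter_lt hlength.le hvals
  change HasBits (T.count (T.automaton vals)) k _ at hbits
  obtain ⟨hbit, hhigh⟩ := hasBits_cons.1 hbits
  have hle : μ ≤ T.count (T.automaton vals) := hμ.2 ⟨_, hfeasible, rfl⟩
  have hlt := T.count_lt (T.automaton vals)
  rw [← h.length_known] at hlt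
  have heq := h.hasBits.div_two_pow_eq hhigh (hle.trans_lt hlt) hlt
  have hμdiv := div_two_pow_eq_add_testBit μ k
  have hdiv := div_two_pow_eq_add_testBit (T.count (T.automaton vals)) k
  have hle' : μ / 2 ^ k ≤ T.count (T.automaton vals) / 2 ^ k := Nat.div_le_div_right hle
  rw [hbit, Bool.toNat_false] at hdiv
  have hμbit : μ.testBit k = false := Bool.toNat_eq_zero.1 (by omega)
  exact ⟨hlength, hfeasible, hasBits_cons.2 ⟨hμbit, h.hasBits⟩, by dsimp only; omega⟩

theorem of_unsat (hμ : IsLeast (T.count '' {A | T.Feasible A}) μ) (h : SearchInv T μ (k + 1) s)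
    (hunsat : ∀ w, ¬ Cnf.Sat w (T.query k s.known).toCnf) :
    SearchInv T μ k ⟨true :: s.known, s.best⟩ := by
  have hμbit : μ.testBit k = true := by
    by_contra hμbit
    rw [Bool.not_eq_true] at hμbit
    obtain ⟨A, hA, rfl⟩ := hμ.1
    obtain ⟨w, hw⟩ := exists_sat_formula hA (hasBits_cons.2 ⟨hμbit, h.hasBits⟩)
    exact hunsat w hw
  refine ⟨?_, h.feasible, hasBits_cons.2 ⟨hμbit, h.hasBits⟩, ?_⟩
  · rw [← h.length_known, List.length_cons]
    omega
  · have hμdiv := div_two_pow_eq_add_testBit μ k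
    have hdiv := div_two_pow_eq_add_testBit (T.count (T.automaton s.best)) k
    have := Bool.toNat_le ((T.count (T.automaton s.best)).testBit k)
    have := h.count_le
    rw [hμbit, Bool.toNat_true] at hμdiv
    dsimp only
    omega

theorem update (hT : T.WellFormed) (hμ : IsLeast (T.count '' {A | T.Feasible A}) μ)
    (h : SearchInv T μ (k + 1) s) (S : SatSolver) :
    SearchInv T μ k (s.update (answer S (T.query k s.known))) := by
  rcases ha : answer S (T.query k s.known) with _ | vals
  · exact h.of_unsat hμ (not_sat_of_answer_eq_none ha)
  · exact h.of_satisfies hT hμ (satisfies_of_answer_eq_some ha)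

end SearchInv

/-! ### The program -/

theorem PolyTime.toProd_task : PolyTime fun T : Task => (T.letters, T.states, T.words) :=
  .of_enc_eq fun _ => rfl

@[fun_prop]
theorem PolyTime.task_letters : PolyTime Task.letters := PolyTime.fst.comp toProd_task

@[fun_prop]
theorem PolyTime.task_states : PolyTime Task.states :=
  PolyTime.fst.comp (PolyTime.snd.comp toProd_task)

@[fun_prop]
theorem PolyTime.task_words : PolyTime Task.words :=
  PolyTime.snd.comp (PolyTime.snd.comp toProd_task)

@[fun_prop]
theorem PolyTime.searchState_known : PolyTime SearchState.known := .of_enc_eq_hd fun _ => rfl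

@[fun_prop]
theorem PolyTime.searchState_best : PolyTime SearchState.best := .of_enc_eq_tl fun _ => rfl

section
variable {α : Type} [Enc α] {f g : α → List Bool}

@[fun_prop]
theorem PolyTime.searchState_mk (hf : PolyTime f) (hg : PolyTime g) :
    PolyTime fun x => SearchState.mk (f x) (g x) :=
  (hf.prodMk hg).of_enc_eq_enc fun _ => rfl

@[fun_prop]
theorem PolyTime.task_width {T : α → Task} (hT : PolyTime T) : PolyTime fun x => (T x).width := by
  unfold Task.width; fun_prop

@[fun_prop]
theorem PolyTime.task_query {T : α → Task} {k : α → ℕ} (hT : PolyTime T) (hk : PolyTime k)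
    (hf : PolyTime f) : PolyTime fun x => (T x).query (k x) (f x) := by
  unfold Task.query; fun_prop

@[fun_prop]
theorem PolyTime.searchState_update {s : α → SearchState} {a : α → Option (List Bool)}
    (hs : PolyTime s) (ha : PolyTime a) : PolyTime fun x => (s x).update (a x) := by
  have h : PolyTime fun x => SearchState.mk ((!(a x).isSome) :: (s x).known)
      (bif (a x).isSome then (a x).getD [] else (s x).best) := by fun_prop
  exact h.congr fun x => by rw [SearchState.update]; cases a x <;> rfl

@[fun_prop]
theorem PolyTime.table_automaton {T : α → Task} (hT : PolyTime T) (hf : PolyTime f) :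
    PolyTime fun x => ((T x).automaton (f x)).table (T x).letters (T x).states := by
  unfold NatDFA.table Task.automaton NatDFA.ofValuation readStep valuation; dsimp only; fun_prop

end

theorem exists_esize_query_le : ∃ Z : ℕ[X], ∀ (T : Task) (k : ℕ) (known : List Bool),
    k + known.length ≤ T.width → esize (T.query k known) ≤ Z.eval (esize T) := by
  have hquery : PolyBounded fun x : Task × ℕ × List Bool => esize (x.1.query x.2.1 x.2.2) := by
    fun_prop
  obtain ⟨Q, hQ⟩ := hquery
  have hbound : PolyBounded fun T : Task => Q.eval (4 + esize T + 4 * esize T.width) := by fun_prop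
  refine hbound.imp fun Z hZ T k known h => ?_
  refine (hQ (T, k, known)).trans ((eval_mono Q ?_).trans (hZ T))
  have := esize_bools_le known
  simp only [esize_pair, esize_nat]
  omega

theorem SearchInv.esize_le {T : Task} {μ k B : ℕ} {s : SearchState} (h : SearchInv T μ k s)
    (hB : s.best.length ≤ B) : esize (k, s, T) ≤ 6 + 2 * esize T.width + 4 * B + esize T := by
  have hs : esize s = 1 + esize s.known + esize s.best := rfl
  have := esize_bools_le s.known
  have := esize_bools_le s.best
  have := h.length_known
  simp only [esize_pair, esize_nat] at *
  omega

theorem SearchState.length_best_update_le (s : SearchState) {S : SatSolver} {φ : Formula} {B : ℕ}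
    (hs : s.best.length ≤ B) (hφ : esize φ ≤ B) : (s.update (answer S φ)).best.length ≤ B := by
  rcases ha : answer S φ with _ | vals
  · exact hs
  · exact (length_le_of_answer_eq_some ha).trans hφ

theorem exists_search_loop : ∃ (p : Prog) (P : ℕ[X]), ∀ (S : SatSolver) (T : Task) (μ : ℕ),
    T.WellFormed → IsLeast (T.count '' {A | T.Feasible A}) μ →
    ∃ s t qs, Run S p (enc (T.width, (⟨[], []⟩ : SearchState), T)) (enc (0, s, T)) t qs ∧
      SearchInv T μ 0 s ∧ t ≤ P.eval (esize T) ∧ qs.length ≤ T.width ∧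
      ∀ φ ∈ qs, φ.size ≤ P.eval (esize T) := by
  obtain ⟨p, P, hloop⟩ := exists_query_loop (σ := SearchState × Task)
    (query := fun x => x.2.2.query x.1 x.2.1.known)
    (update := fun x => (x.2.2.1.update x.1, x.2.2.2)) (by fun_prop) (by fun_prop)
  obtain ⟨Z, hZ⟩ := exists_esize_query_le
  let M (T : Task) := 6 + 2 * esize T.width + 4 * Z.eval (esize T) + esize T
  have hbound : PolyBounded fun T : Task => (esize T.width + 1) * (1 + M T + P.eval (M T)) := by
    fun_prop
  obtain ⟨R, hR⟩ := hbound
  refine ⟨p, R, fun S T μ hT hμ => ?_⟩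
  have hstart := SearchInv.initial hT μ
  obtain ⟨⟨s, T⟩, t, qs, hrun, ⟨rfl, hs, -⟩, ht, hlength, hqs⟩ := hloop S
    (fun k x => x.2 = T ∧ SearchInv T μ k x.1 ∧ x.1.best.length ≤ Z.eval (esize T)) (M T)
    (fun k ⟨s, _⟩ ⟨hT', hs, hbest⟩ => hT' ▸ hs.esize_le hbest)
    (fun k ⟨s, _⟩ ⟨hT', hs, hbest⟩ => by
      subst hT'
      refine ⟨rfl, hs.update hT hμ S, s.length_best_update_le hbest (hZ _ _ _ ?_)⟩
      have := hs.length_known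
      dsimp only at this ⊢
      omega)
    T.width (⟨[], []⟩, T) ⟨rfl, hstart, by simp⟩
  have hlength_le : T.width + 1 ≤ esize T.width + 1 := by rw [esize_nat]; omega
  have hbound := hR T
  dsimp only at hbound
  refine ⟨s, t, qs, hrun, hs, ht.trans (le_trans (by gcongr) hbound), hlength, fun φ hφ =>
    (hqs φ hφ).trans (le_trans ?_ hbound)⟩
  exact (Nat.le_add_left _ _).trans (Nat.le_mul_of_pos_left _ (Nat.succ_pos _))

theorem exists_program : ∃ (p : Prog) (P : ℕ[X]), ∀ (S : SatSolver) (T : Task), T.WellFormed →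
    ∃ A t qs, Run S p (enc T) (enc (NatDFA.table A T.letters T.states)) t qs ∧ T.Feasible A ∧
      (∀ B, T.Feasible B → T.count A ≤ T.count B) ∧ t ≤ P.eval (esize T) ∧
      qs.length ≤ T.width ∧ ∀ φ ∈ qs, φ.size ≤ P.eval (esize T) := by
  obtain ⟨loop, L, hloop⟩ := exists_search_loop
  have hstart : PolyTime fun T : Task => (T.width, (⟨[], []⟩ : SearchState), T) := by fun_prop
  have hout : PolyTime fun x : ℕ × SearchState × Task =>
      (x.2.2.automaton x.2.1.best).table x.2.2.letters x.2.2.states := by fun_prop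
  obtain ⟨start, P, hstart⟩ := hstart
  obtain ⟨out, Q, hout⟩ := hout
  have hbound : PolyBounded fun T : Task => 2 + esize T + P.eval (esize T) +
    P.eval (esize T) + L.eval (esize T) + Q.eval (L.eval (esize T)) := by fun_prop
  obtain ⟨R, hR⟩ := hbound
  refine ⟨.seq start (.seq loop out), R, fun S T hT => ?_⟩
  obtain ⟨μ, hμ⟩ := T.exists_isLeast_count hT
  obtain ⟨s, t, qs, hrun, hs, ht, hlength, hqs⟩ := hloop S T μ hT hμ
  obtain ⟨tinit, hruninit, htinit⟩ := hstart S T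
  obtain ⟨tout, hrunout, htout⟩ := hout S (0, s, T)
  have hsize := hruninit.size_le
  have hmono := eval_mono Q (hrun.size_le.trans ht)
  have hbound := hR T
  simp only [esize] at *
  refine ⟨_, _, _, .seq hruninit (.seq hrun hrunout), hs.feasible, fun B hB => ?_, by omega,
    by simpa using hlength, fun φ hφ => (hqs φ (by simpa using hφ)).trans (by omega)⟩
  have := hs.count_le
  rw [pow_zero, Nat.div_one, Nat.div_one] at this
  exact this.trans (hμ.2 ⟨B, hB, rfl⟩)

/-! ### The learning task -/

theorem NatDFA.solvesTask_toDFA {A : NatDFA} {m n : ℕ} {l : List (List (Fin m))} (hn : 1 ≤ n)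
    (hA : A.Consistent m n (l.map (List.map Fin.val)))
    (hmin : ∀ B : NatDFA, B.Consistent m n (l.map (List.map Fin.val)) →
      A.countFrom m (2 * n - 1) 0 ≤ B.countFrom m (2 * n - 1) 0) :
    SolvesTask {w | w ∈ l} n { State := Fin n, toDFA := A.toDFA hn hA.step_lt } := by
  have hlang := lang_toDFA hn hA.step_lt
  refine ⟨⟨(Fintype.card_fin n).le, ?_⟩, ?_⟩
  · rw [hlang]
    exact (consistent_iff hA.step_lt).1 hA
  · rintro B ⟨hsize, haccepts⟩
    obtain ⟨B', hB', hB⟩ := B.exists_natDFA hsize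
    have hlength : 2 * n - 2 + 1 = 2 * n - 1 := by omega
    rw [CountLT, count_eq_of_lang_eq hlang, count_eq_of_lang_eq hB, hlength, not_lt]
    exact hmin B' ((consistent_iff hB').2 (hB ▸ haccepts))

theorem Task.wellFormed_mk {m n : ℕ} (hn : 1 ≤ n) (l : List (List (Fin m))) :
    Task.WellFormed ⟨m, n, l.map (List.map Fin.val)⟩ :=
  ⟨hn, List.forall_mem_map.2 fun _ _ => List.forall_mem_map.2 fun a _ => a.2⟩

theorem countBits_le_mul_pow {m n c : ℕ} (hm : 1 ≤ m) (hc : 6 ≤ c) :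
    countBits m (2 * n - 1) ≤ c * (m + n) ^ c := by
  calc countBits m (2 * n - 1) ≤ (m + 2) * (2 * n - 1) := countBits_le m _
    _ ≤ 3 * (m + n) * (2 * (m + n)) := by gcongr <;> omega
    _ = 6 * (m + n) ^ 2 := by ring
    _ ≤ c * (m + n) ^ c := by gcongr <;> omega

theorem exists_eval_esize_input_le (P : ℕ[X]) :
    ∃ c : ℕ, 6 ≤ c ∧ ∀ {m : ℕ} (n : ℕ) {l : List (List (Fin m))}, 1 ≤ m → l.Nodup →
      P.eval (esize (m, n, l.map (List.map Fin.val))) ≤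
        c * (m + (Pref {w | w ∈ l}).ncard + n) ^ c := by
  obtain ⟨c, hc⟩ := exists_eval_le_mul_pow (P.comp (C 13 * X ^ 3))
  refine ⟨c + 6, by omega, fun {m} n {l} hm hl => ?_⟩
  have hN : 1 ≤ m + (Pref {w | w ∈ l}).ncard + n := by omega
  have hcubic := eval_mono P (esize_input_le n hm hl)
  have hc := hc _ hN
  rw [eval_comp, eval_mul, eval_C, eval_pow, eval_X] at hc
  exact hcubic.trans (hc.trans (mul_pow_self_mono (Nat.le_add_right c 6) hN))

end DFALearning

theorem mainTheorem3 :
    ∃ (p : DFALearning.Prog) (c : ℕ),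
      ∀ (S : DFALearning.SatSolver) (m n : ℕ), 1 ≤ m → 1 ≤ n →
      ∀ (P : Set (List (Fin m))) (l : List (List (Fin m))),
        l.Nodup → (∀ w, w ∈ l ↔ w ∈ P) →
        ∃ (s : ℕ) (A : DFA (Fin m) (Fin s)) (t : ℕ) (qs : List DFALearning.Cnf),
          DFALearning.Run S p (DFALearning.encInput m n l) (DFALearning.encDFA A) t qs ∧
          DFALearning.SolvesTask P n { State := Fin s, toDFA := A } ∧
          t ≤ c * (m + (DFALearning.Pref P).ncard + n) ^ c ∧
          qs.length ≤ c * (m + n) ^ c ∧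
          (2 ≤ m → (qs.length : ℝ) ≤ (2 * (n : ℝ) - 1) * Real.logb 2 (m : ℝ)) ∧
          ∀ φ ∈ qs, φ.size ≤ c * (m + (DFALearning.Pref P).ncard + n) ^ c := by
  open DFALearning in
  obtain ⟨p, T, hp⟩ := exists_program
  obtain ⟨c, hc, hbound⟩ := exists_eval_esize_input_le T
  refine ⟨p, c, fun S m n hm hn P l hnodup hl => ?_⟩
  obtain rfl : {w | w ∈ l} = P := Set.ext hl
  obtain ⟨A, t, qs, hrun, hA, hmin, ht, hlength, hqs⟩ :=
    hp S ⟨m, n, l.map (List.map Fin.val)⟩ (Task.wellFormed_mk hn l)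
  change A.Consistent m n _ at hA
  refine ⟨n, A.toDFA hn hA.step_lt, t, qs, ?_, A.solvesTask_toDFA hn hA hmin,
    ht.trans (hbound n hm hnodup), hlength.trans (countBits_le_mul_pow hm hc), fun hm2 => ?_,
    fun φ hφ => (hqs φ hφ).trans (hbound n hm hnodup)⟩
  · rw [encInput_eq, NatDFA.encDFA_toDFA hn hA.step_lt]
    exact hrun
  · have hcast : ((2 * n - 1 : ℕ) : ℝ) = 2 * n - 1 := by
      rw [Nat.cast_sub (by omega)]
      norm_num
    rw [← hcast]
    exact (Nat.cast_le.2 hlength).trans (countBits_le_logb hm2 _)
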